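/- Consider $K \ge 1$ arms and a horizon $T$. An environment consists of reward distributions $f_t^k$ on $\mathbb R$ $(1\le t\le T,\ 1\le k\le K)$ with means $\mu_t^k$. In time slot $t$ a policy selects an arm $\varphi_t$ on the basis of the past observations $(\varphi_s,X_s)_{s<t}$ and receives a reward $X_t$ which, given the past and $\varphi_t=k$, has distribution $f_t^k$. With $\mu_t^*=\max_k\mu_t^k$, the regret of a policy is $$R_T=\mathbb E\Big[\sum_{t=1}^T(\mu_t^*-\mu_t^{\varphi_t})\Big].$$ For $V>0$, $a\in\mathbb R$ and $b>0$ let $\mathcal E_{a,b}(V,T,K)$ be the set of environments such that, for all $t\le T$ and all $k$, $\int e^{\lambda(x-\mu_t^k)}\,df_t^k(x)\le e^{\lambda^2/8}$ for every $\lambda\in\mathbb R$ and $\mu_t^k\in[a,a+b]$, and such that $$\sum_{t=1}^{T-1}\max_{k}|\mu_{t+1}^k-\mu_t^k|\le V .$$ Sliding-Window MOSS (SW-MOSS) with parameter $\eta>1/2$ and window length $\tau\in\mathbb N$ picks each arm once in the first $K$ time slots. In every later slot $t$ it picks an arm $k$ that maximizes the index $$g_t^k=\frac1{n_k(t)}\sum_{s\in\mathcal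 W_t,\ \varphi_s=k}X_s+\sqrt{\frac{\eta\,\max\big(\ln\frac{\tau}{K\,n_k(t)},\,0\big)}{n_k(t)}},\qquad n_k(t)=\big|\{s\in\mathcal W_t:\varphi_s=k\}\big|,$$ where $\mathcal W_t=\{\max(1,t-\tau),\dots,t-1\}$ and $g_t^k=+\infty$ if $n_k(t)=0$. The order of the first $K$ picks is arbitrary, and ties are broken arbitrarily. **Theorem.** For all $\eta>1/2$ and $b>0$ there is a constant $C$, depending only on $\eta$ and $b$, such that for all $a\in\mathbb R$, all $K\ge1$, all $T$ and all $V>0$ for which $\tau=\lceil K^{1/3}(T/V)^{2/3}\rceil$ satisfies $\tau\le T$, SW-MOSS with parameter $\eta$ and window length $\tau$ has worst-case regret $$\sup_{\mathcal E_{a,b}(V,T,K)}R_T\;\le\; C\,(KV)^{1/3}\,T^{2/3}.$$ -/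

import Mathlib

open MeasureTheory ProbabilityTheory

noncomputable section

namespace Bandit

/-- Observations of the first `t` rounds: the selected arm and the received reward of each.
Rounds are numbered from `0`, so that round `t` here is time slot `t + 1`. -/
abbrev Hist (K t : ℕ) : Type := Fin t → Fin K × ℝ

/-- A (possibly randomized) policy: the conditional distribution of the arm selected in round `t`,
given the observations of the rounds before. -/
structure Policy (K : ℕ) where
  act : (t : ℕ) → Kernel (Hist K t) (Fin K)
  markov : ∀ t, IsMarkovKernel (act t)

/-- Reward distributions `f_t^k`; for a horizon `T` only the rounds `t < T` matter. -/
abbrev Env (K : ℕ) : Type := ℕ → Fin K → ProbabilityMeasure ℝ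

/-- The mean reward `μ_t^k`. -/
def Env.mean {K : ℕ} (F : Env K) (t : ℕ) (k : Fin K) : ℝ :=
  ∫ x, x ∂(F t k : Measure ℝ)

/-- The mean reward `μ_t^*` of the best arm. -/
def Env.bestMean {K : ℕ} (F : Env K) (t : ℕ) : ℝ := ⨆ k, F.mean t k

/-- The total variation of the mean rewards over the horizon `T`. -/
def Env.variation {K : ℕ} (F : Env K) (T : ℕ) : ℝ :=
  ∑ t ∈ Finset.range (T - 1), ⨆ k, |F.mean (t + 1) k - F.mean t k|

/-- The environments over the horizon `T` with total variation at most `V`, whose rewards satisfy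
`E exp (l (X - μ)) ≤ exp (l ^ 2 / 8)` for all real `l` and have means in `[a, a + b]`. -/
def envClass (K T : ℕ) (V a b : ℝ) : Set (Env K) :=
  {F | (∀ t < T, ∀ k,
          HasSubgaussianMGF (fun x : ℝ => x - F.mean t k) (1 / 4) (F t k : Measure ℝ) ∧
          F.mean t k ∈ Set.Icc a (a + b)) ∧
       F.variation T ≤ V}

/-- The reward distribution in round `t` as a function of the selected arm. -/
def Env.rewardKernel {K : ℕ} (F : Env K) (t : ℕ) : Kernel (Fin K) ℝ :=
  Kernel.ofFunOfCountable fun k => (F t k : Measure ℝ)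

/-- The law of the observations of the first `t` rounds: in each round an arm is drawn by the
policy from the past observations, and then its reward is drawn independently of the past. -/
def Policy.law {K : ℕ} (π : Policy K) (F : Env K) : (t : ℕ) → Measure (Hist K t)
  | 0 => Measure.dirac Fin.elim0
  | t + 1 =>
      (π.law F t ⊗ₘ (π.act t ⊗ₖ Kernel.prodMkLeft (Hist K t) (F.rewardKernel t))).map
        fun p => (Fin.snoc p.1 p.2 : Hist K (t + 1))

/-- The regret `E [∑ t, (μ_t^* - μ_t^{φ_t})]` over the horizon `T`. -/
def Policy.regret {K : ℕ} (π : Policy K) (F : Env K) (T : ℕ) : ℝ :=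
  ∫ h, ∑ t : Fin T, (F.bestMean t - F.mean t (h t).1) ∂(π.law F T)

/-- The supremum of the regret over the environments in `envClass K T V a b`. -/
def Policy.worstCaseRegret {K : ℕ} (π : Policy K) (T : ℕ) (V a b : ℝ) : EReal :=
  ⨆ F ∈ envClass K T V a b, (π.regret F T : EReal)

/-- The rounds among the last `τ` ones before round `t` in which arm `k` was selected. -/
def windowPicks {K t : ℕ} (τ : ℕ) (h : Hist K t) (k : Fin K) : Finset (Fin t) :=
  {s : Fin t | t ≤ (s : ℕ) + τ ∧ (h s).1 = k}

/-- The index of arm `k` in round `t`, computed within the sliding window. It is infinite for an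
arm without a sample in the window. -/
def swIndex {K t : ℕ} (η : ℝ) (τ : ℕ) (h : Hist K t) (k : Fin K) : EReal :=
  let n : ℕ := (windowPicks τ h k).card
  if n = 0 then ⊤
  else (((∑ s ∈ windowPicks τ h k, (h s).2) / n
    + √(η * (max (Real.log (τ / (K * n))) 0 / n)) : ℝ) : EReal)

/-- `π` is Sliding-Window MOSS with window length `τ` up to the horizon `T`: in the first `K` rounds
it picks each arm once, in any order; from then on it picks an arm of maximal index, where ties may
be broken in any way. -/
structure Policy.IsSWMOSS {K : ℕ} (π : Policy K) (η : ℝ) (τ T : ℕ) : Prop where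
  init : ∀ t < T, t < K → ∀ (h : Hist K t) (k : Fin K),
    π.act t h {k} ≠ 0 → ∀ s, (h s).1 ≠ k
  argmax : ∀ t < T, K ≤ t → ∀ (h : Hist K t) (k : Fin K),
    π.act t h {k} ≠ 0 → ∀ j, swIndex η τ h j ≤ swIndex η τ h k

/-- The window length `⌈K ^ (1/3) (T / V) ^ (2/3)⌉`. -/
def swWindow (K T : ℕ) (V : ℝ) : ℕ :=
  ⌈(K : ℝ) ^ (1 / 3 : ℝ) * ((T : ℝ) / V) ^ (2 / 3 : ℝ)⌉₊

end Bandit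

end

open MeasureTheory ProbabilityTheory

noncomputable section

namespace Bandit

/-! ### Elementary sums and dyadic chaining -/

/-! Write `H = τ / K`. The goal is regret of order `T / √H + τ V`; the prescribed window balances
the two terms (`window_bounds`).

Since the selected arm has maximal index, the regret of a round after the first `K` is at most twice
the drift of the means within the window, plus the shortfall of the index of the best arm, plus the
excess of the index of the selected arm, plus `b` if the selected arm has no sample in the window
(`bestMean_sub_mean_le`). The drifts add up to at most `τ V`. In an epoch of length `τ` each arm is
selected at most once without a sample, which costs order `b K` per epoch.

The best arm of a round is deterministic, so the shortfall concerns a fixed arm and a fixed window.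
Only its number of samples is random. Splitting that number dyadically and using the exponential
supermartingale at one parameter per scale bounds the expected shortfall by `C / √H`
(`exists_lintegral_shortfall_le`). The scales sum geometrically because `η > 1 / 2`.

The excess concerns an arm chosen from the data, in a moving window. A union bound over arms would
cost a logarithm; instead each arm is charged in proportion to its selections. For each arm and
epoch, `Env.chainEnergy` collects weighted eighth powers of the noise over dyadic blocks of its
selections. Its expectation is of order one plus the expected number of selections divided by `H`
(`lintegral_chainEnergy_le`), while chaining controls every window sum pathwise by its eighth root
(`abs_noiseSum_le`). Adding over the selections in an epoch and applying Young's inequality gives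
`√H (1 + energy + selections / H)` per arm (`sum_excess_le`). Over all arms this is of order `K √H`
in expectation, and the at most `2 T / τ` epochs contribute order `T / √H`. -/

theorem sum_min_geom_le {ρ y : ℝ} (hρ : 1 < ρ) (hy : 0 < y) (n : ℕ) :
    ∑ i ∈ Finset.range n, min (y * ρ ^ i) (1 / (y * ρ ^ i)) ≤ 4 * ρ / (ρ - 1) := by
  have hρ0 : 0 < ρ := by linarith
  have hρ1 : 0 < ρ - 1 := by linarith
  -- Here `min x (1 / x) ≤ 4 x / (1 + x) ^ 2`, which is dominated by a multiple of the increment of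
  -- `x / (1 + x)` from `x` to `ρ x`; along the geometric sequence these increments telescope.
  have step : ∀ x : ℝ, 0 < x →
      min x (1 / x) ≤ 4 * ρ / (ρ - 1) * (ρ * x / (1 + ρ * x) - x / (1 + x)) := by
    intro x hx
    have h1 : 0 < 1 + x := by linarith
    have h2 : 0 < 1 + ρ * x := by positivity
    have e : 4 * ρ / (ρ - 1) * (ρ * x / (1 + ρ * x) - x / (1 + x))
        = 4 * ρ * x / ((1 + ρ * x) * (1 + x)) := by
      field_simp
      ring
    rw [e]
    have h3 : 4 * x / (1 + x) ^ 2 ≤ 4 * ρ * x / ((1 + ρ * x) * (1 + x)) := by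
      rw [div_le_div_iff₀ (by positivity) (by positivity)]
      have : 0 ≤ 4 * x * (1 + x) * (ρ - 1) := by positivity
      nlinarith
    refine le_trans ?_ h3
    rcases le_total x 1 with hx1 | hx1
    · refine (min_le_left _ _).trans ?_
      rw [le_div_iff₀ (by positivity)]
      nlinarith [mul_nonneg hx.le (mul_nonneg (sub_nonneg.2 hx1) (by linarith : 0 ≤ 3 + x))]
    · refine (min_le_right _ _).trans ?_
      rw [div_le_div_iff₀ hx (by positivity)]
      nlinarith
  have key : ∀ n : ℕ, ∑ i ∈ Finset.range n, min (y * ρ ^ i) (1 / (y * ρ ^ i))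
      ≤ 4 * ρ / (ρ - 1) * (y * ρ ^ n / (1 + y * ρ ^ n)) := by
    intro n
    induction n with
    | zero => simp; positivity
    | succ n ih =>
      rw [Finset.sum_range_succ]
      have h := step (y * ρ ^ n) (by positivity)
      have e : ρ * (y * ρ ^ n) = y * ρ ^ (n + 1) := by ring
      rw [e] at h
      linarith
  refine (key n).trans ?_
  have h0 : 0 ≤ 4 * ρ / (ρ - 1) := by positivity
  have h1 : 0 < y * ρ ^ n := by positivity
  refine mul_le_of_le_one_right h0 ?_
  rw [div_le_one (by linarith)]
  linarith

/-- Moving both endpoints inward to even numbers costs at most one unit step at each end, hence `2 *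
D 0`; what remains is the same problem for `i ↦ f (2 * i)` with one scale fewer. -/
theorem abs_sub_le_dyadic (J : ℕ) : ∀ (f D : ℕ → ℝ),
    (∀ j < J, ∀ i, |f ((i + 1) * 2 ^ j) - f (i * 2 ^ j)| ≤ D j) →
    ∀ m l : ℕ, m ≤ l → l - m < 2 ^ J → |f l - f m| ≤ 2 * ∑ j ∈ Finset.range J, D j := by
  induction J with
  | zero =>
    intro f D _ m l hml hJ
    have : l = m := by simp at hJ; omega
    simp [this]
  | succ J ih =>
    intro f D hD m l hml hJ
    have h0 : ∀ i, |f (i + 1) - f i| ≤ D 0 := fun i => by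
      simpa using hD 0 (Nat.succ_pos J) i
    have hD0 : 0 ≤ D 0 := (abs_nonneg _).trans (h0 0)
    have hIH := ih (fun i => f (2 * i)) (fun j => D (j + 1)) (fun j hj i => by
      have := hD (j + 1) (by omega) i
      have e1 : (i + 1) * 2 ^ (j + 1) = 2 * ((i + 1) * 2 ^ j) := by ring
      have e2 : i * 2 ^ (j + 1) = 2 * (i * 2 ^ j) := by ring
      rwa [e1, e2] at this)
    rw [Finset.sum_range_succ']
    have hDs : 0 ≤ ∑ j ∈ Finset.range J, D (j + 1) := Finset.sum_nonneg fun j hj =>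
      (abs_nonneg _).trans (hD (j + 1) (by simpa using hj) 0)
    have hl : |f l - f (2 * (l / 2))| ≤ D 0 := by
      rcases Nat.even_or_odd' l with ⟨q, rfl | rfl⟩
      · have : 2 * q / 2 = q := by omega
        simpa [this] using hD0
      · have : (2 * q + 1) / 2 = q := by omega
        rw [this]; exact h0 _
    have hm : |f (2 * ((m + 1) / 2)) - f m| ≤ D 0 := by
      rcases Nat.even_or_odd' m with ⟨q, rfl | rfl⟩
      · have : (2 * q + 1) / 2 = q := by omega
        simpa [this] using hD0
      · have : (2 * q + 1 + 1) / 2 = q + 1 := by omega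
        rw [this]; exact h0 _
    by_cases hc : (m + 1) / 2 ≤ l / 2
    · have h := hIH ((m + 1) / 2) (l / 2) hc (by rw [pow_succ] at hJ; omega)
      have := abs_add_three (f l - f (2 * (l / 2)))
        (f (2 * (l / 2)) - f (2 * ((m + 1) / 2))) (f (2 * ((m + 1) / 2)) - f m)
      have e : f l - f (2 * (l / 2)) + (f (2 * (l / 2)) - f (2 * ((m + 1) / 2)))
        + (f (2 * ((m + 1) / 2)) - f m) = f l - f m := by ring
      rw [e] at this
      linarith
    · have : l = m := by omega
      rw [this]
      simp only [sub_self, abs_zero]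
      linarith

theorem sum_geom_le {x : ℝ} (hx : 1 < x) (J : ℕ) :
    ∑ j ∈ Finset.range (J + 1), x ^ j ≤ x / (x - 1) * x ^ J := by
  have h : 0 < x - 1 := by linarith
  rw [geom_sum_eq hx.ne', div_mul_eq_mul_div, div_le_div_iff_of_pos_right h, pow_succ]
  linarith [mul_comm x (x ^ J)]

theorem inv_four_mul_le_rpow_quarter_sub (N : ℕ) :
    1 / (4 * ((N + 1 : ℝ) ^ (1 / 4 : ℝ)) ^ 3)
      ≤ (N + 1 : ℝ) ^ (1 / 4 : ℝ) - (N : ℝ) ^ (1 / 4 : ℝ) := by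
  set y := (N + 1 : ℝ) ^ (1 / 4 : ℝ) with hy
  set x := (N : ℝ) ^ (1 / 4 : ℝ) with hx
  have hy0 : 0 < y := by positivity
  have hx0 : 0 ≤ x := by positivity
  have hxy : x ≤ y := Real.rpow_le_rpow (by positivity) (by linarith) (by norm_num)
  have hy4 : y ^ 4 = N + 1 := by
    rw [hy, ← Real.rpow_natCast, ← Real.rpow_mul (by positivity)]; norm_num
  have hx4 : x ^ 4 = N := by
    rw [hx, ← Real.rpow_natCast, ← Real.rpow_mul (by positivity)]; norm_num
  rw [div_le_iff₀ (by positivity)]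
  have h1 : (y - x) * (y ^ 3 + y ^ 2 * x + y * x ^ 2 + x ^ 3) = 1 := by
    have : (y - x) * (y ^ 3 + y ^ 2 * x + y * x ^ 2 + x ^ 3) = y ^ 4 - x ^ 4 := by ring
    rw [this, hy4, hx4]; ring
  have h2 : y ^ 3 + y ^ 2 * x + y * x ^ 2 + x ^ 3 ≤ 4 * y ^ 3 := by
    have a1 : y ^ 2 * x ≤ y ^ 2 * y := by gcongr
    have a2 : y * x ^ 2 ≤ y * y ^ 2 := by gcongr
    have a3 : x ^ 3 ≤ y ^ 3 := by gcongr
    nlinarith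
  calc (1 : ℝ) = (y - x) * (y ^ 3 + y ^ 2 * x + y * x ^ 2 + x ^ 3) := h1.symm
    _ ≤ (y - x) * (4 * y ^ 3) := mul_le_mul_of_nonneg_left h2 (by linarith)

theorem rpow_mul_nat {x : ℝ} (hx : 0 ≤ x) (p q : ℝ) (n : ℕ) (h : p = q * n) :
    x ^ p = (x ^ q) ^ n := by
  rw [h, Real.rpow_mul hx, Real.rpow_natCast]

theorem sum_rpow_neg_three_quarters_le (N : ℕ) :
    ∑ j ∈ Finset.range N, ((j + 1 : ℝ) ^ (3 / 4 : ℝ))⁻¹ ≤ 4 * (N : ℝ) ^ (1 / 4 : ℝ) := by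
  induction N with
  | zero => simp
  | succ N ih =>
    rw [Finset.sum_range_succ]
    have h := inv_four_mul_le_rpow_quarter_sub N
    rw [rpow_mul_nat (by positivity : (0 : ℝ) ≤ N + 1) (3 / 4) (1 / 4) 3 (by norm_num)]
    have hy0 : 0 < (N + 1 : ℝ) ^ (1 / 4 : ℝ) := by positivity
    push_cast
    have e : (((N + 1 : ℝ) ^ (1 / 4 : ℝ)) ^ 3)⁻¹ = 4 * (1 / (4 * ((N + 1 : ℝ) ^ (1 / 4 : ℝ)) ^ 3)) := by
      field_simp
    rw [e]; linarith

theorem sum_rpow_neg_quarter_le (N : ℕ) :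
    ∑ j ∈ Finset.range N, ((j + 1 : ℝ) ^ (1 / 4 : ℝ))⁻¹ ≤ 4 * (N : ℝ) ^ (3 / 4 : ℝ) := by
  induction N with
  | zero => simp
  | succ N ih =>
    rw [Finset.sum_range_succ]
    have h := inv_four_mul_le_rpow_quarter_sub N
    push_cast
    rw [rpow_mul_nat (by positivity : (0 : ℝ) ≤ N + 1) (3 / 4) (1 / 4) 3 (by norm_num)]
    rw [rpow_mul_nat (by positivity : (0 : ℝ) ≤ N) (3 / 4) (1 / 4) 3 (by norm_num)] at ih
    set y := (N + 1 : ℝ) ^ (1 / 4 : ℝ) with hy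
    set x := (N : ℝ) ^ (1 / 4 : ℝ) with hx
    have hy0 : 0 < y := by positivity
    have hx0 : 0 ≤ x := by positivity
    have hxy : x ≤ y := Real.rpow_le_rpow (by positivity) (by linarith) (by norm_num)
    have h1 : (1 / (4 * y ^ 3)) * y ^ 2 ≤ (y - x) * (y ^ 2 + x * y + x ^ 2) := by
      apply mul_le_mul h _ (by positivity) (by linarith)
      nlinarith [mul_nonneg hx0 hy0.le, sq_nonneg x]
    have e1 : (1 / (4 * y ^ 3)) * y ^ 2 = y⁻¹ / 4 := by field_simp
    rw [e1] at h1
    nlinarith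

/-- Young's inequality in the crude form used for the noise of the selected arms. -/
theorem rpow_mul_rpow_le_one_add {u v p q : ℝ} (hu : 0 ≤ u) (hv : 0 ≤ v) (hp : 0 ≤ p) (hq : 0 ≤ q)
    (hpq : p + q ≤ 1) : u ^ p * v ^ q ≤ 1 + u + v := by
  have hw : 1 ≤ 1 + u + v := by linarith
  calc u ^ p * v ^ q ≤ (1 + u + v) ^ p * (1 + u + v) ^ q := by
        gcongr <;> linarith
    _ = (1 + u + v) ^ (p + q) := (Real.rpow_add (by linarith) _ _).symm
    _ ≤ (1 + u + v) ^ (1 : ℝ) := Real.rpow_le_rpow_of_exponent_le hw hpq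
    _ = 1 + u + v := Real.rpow_one _

/-! ### The law of the infinite sequence of observations, padded after the last round -/

/-- Observations indexed by all rounds. -/
abbrev Path (K : ℕ) : Type := ℕ → Fin K × ℝ

/-- The observations of the first `t` rounds. -/
def Path.take {K : ℕ} (ω : Path K) (t : ℕ) : Hist K t := fun s => ω s

/-- Extend a history by a fixed observation. -/
def Hist.pad {K t : ℕ} (hK : 0 < K) (h : Hist K t) : Path K :=
  fun s => if hs : s < t then h ⟨s, hs⟩ else (⟨0, hK⟩, 0)

/-- The law of the observations of the first `t` rounds, as a law of padded sequences. -/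
def Policy.pathLaw {K : ℕ} (π : Policy K) (F : Env K) (hK : 0 < K) (t : ℕ) : Measure (Path K) :=
  (π.law F t).map (Hist.pad hK)

variable {K : ℕ}

@[fun_prop]
theorem measurable_take (t : ℕ) : Measurable (fun ω : Path K => ω.take t) :=
  measurable_pi_lambda _ fun _ => measurable_pi_apply _

theorem measurable_pad {t : ℕ} (hK : 0 < K) : Measurable (Hist.pad hK : Hist K t → Path K) := by
  refine measurable_pi_lambda _ fun s => ?_
  unfold Hist.pad
  by_cases hs : s < t
  · simpa [hs] using measurable_pi_apply _
  · simp [hs]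

theorem measurable_snoc {t : ℕ} :
    Measurable (fun p : Hist K t × (Fin K × ℝ) => (Fin.snoc p.1 p.2 : Hist K (t + 1))) := by
  refine measurable_pi_lambda _ fun s => ?_
  refine Fin.lastCases ?_ (fun i => ?_) s
  · simpa using measurable_snd
  · simp only [Fin.snoc_castSucc]
    exact (measurable_pi_apply i).comp measurable_fst

theorem take_pad {t : ℕ} (hK : 0 < K) (h : Hist K t) : (h.pad hK).take t = h := by
  funext s
  simp [Path.take, Hist.pad]

theorem pad_snoc {t : ℕ} (hK : 0 < K) (h : Hist K t) (p : Fin K × ℝ) :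
    Hist.pad hK (Fin.snoc h p : Hist K (t + 1)) = Function.update (h.pad hK) t p := by
  funext s
  rcases lt_trichotomy s t with hs | rfl | hs
  · have : (Fin.snoc h p : Hist K (t + 1)) ⟨s, by omega⟩ = h ⟨s, hs⟩ :=
      Fin.snoc_castSucc (α := fun _ => Fin K × ℝ) p h ⟨s, hs⟩
    simp [Hist.pad, hs, hs.ne, Nat.lt_succ_of_lt hs, this]
  · have : (Fin.snoc h p : Hist K (s + 1)) ⟨s, by omega⟩ = p :=
      Fin.snoc_last (α := fun _ => Fin K × ℝ) p h
    simp [Hist.pad, this]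
  · have h1 : ¬ s < t := by omega
    have h2 : ¬ s < t + 1 := by omega
    rw [Function.update_of_ne hs.ne']
    simp [Hist.pad, h1, h2]

instance (F : Env K) (t : ℕ) : IsMarkovKernel (F.rewardKernel t) :=
  ⟨fun k => by
    change IsProbabilityMeasure ((F t k : Measure ℝ))
    infer_instance⟩

theorem isProbabilityMeasure_law (π : Policy K) (F : Env K) (t : ℕ) :
    IsProbabilityMeasure (π.law F t) := by
  induction t with
  | zero => unfold Policy.law; infer_instance
  | succ t ih =>
    have := π.markov t
    unfold Policy.law
    exact Measure.isProbabilityMeasure_map measurable_snoc.aemeasurable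

theorem isProbabilityMeasure_pathLaw (π : Policy K) (F : Env K) (hK : 0 < K) (t : ℕ) :
    IsProbabilityMeasure (π.pathLaw F hK t) := by
  have := isProbabilityMeasure_law π F t
  exact Measure.isProbabilityMeasure_map (measurable_pad hK).aemeasurable

/-- Padding puts all horizons on one path space, where playing a round means updating one
coordinate. This one-step formula replaces conditional expectations in the inductions below. -/
theorem lintegral_pathLaw_succ (π : Policy K) (F : Env K) (hK : 0 < K) (t : ℕ)
    {f : Path K → ENNReal} (hf : Measurable f) :
    ∫⁻ ω, f ω ∂(π.pathLaw F hK (t + 1))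
      = ∫⁻ ω, ∑ k, (∫⁻ x, f (Function.update ω t (k, x)) ∂(F t k : Measure ℝ))
          * π.act t (ω.take t) {k} ∂(π.pathLaw F hK t) := by
  have := π.markov t
  have := isProbabilityMeasure_law π F t
  have hupd : Measurable fun q : Path K × (Fin K × ℝ) => Function.update q.1 t q.2 := by
    refine measurable_pi_lambda _ fun s => ?_
    by_cases hs : s = t
    · subst hs; simpa using measurable_snd
    · simp only [Function.update_of_ne hs]
      exact (measurable_pi_apply s).comp measurable_fst
  have hm : ∀ k, Measurable fun ω : Path K =>
      ∫⁻ x, f (Function.update ω t (k, x)) ∂(F t k : Measure ℝ) := fun k => by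
    have : Measurable fun q : Path K × ℝ => f (Function.update q.1 t (k, q.2)) :=
      hf.comp (hupd.comp (measurable_fst.prodMk (measurable_const.prodMk measurable_snd)))
    exact this.lintegral_prod_right'
  have hact : ∀ k, Measurable fun ω : Path K => π.act t (ω.take t) {k} := fun k =>
    ((π.act t).measurable_coe (measurableSet_singleton k)).comp (measurable_take t)
  have hsum : Measurable fun ω : Path K =>
      ∑ k, (∫⁻ x, f (Function.update ω t (k, x)) ∂(F t k : Measure ℝ))
        * π.act t (ω.take t) {k} :=
    Finset.measurable_sum _ fun k _ => (hm k).mul (hact k)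
  unfold Policy.pathLaw
  rw [lintegral_map hf (measurable_pad hK), Policy.law,
    lintegral_map (f := fun h => f (Hist.pad hK h)) (hf.comp (measurable_pad hK)) measurable_snoc,
    Measure.lintegral_compProd (f := fun p => f (Hist.pad hK (Fin.snoc p.1 p.2)))
      ((hf.comp (measurable_pad hK)).comp measurable_snoc),
    lintegral_map hsum (measurable_pad hK)]
  refine lintegral_congr fun h => ?_
  rw [Kernel.lintegral_compProd (f := fun b => f (Hist.pad hK (Fin.snoc h b))) _ _ _
    (((hf.comp (measurable_pad hK)).comp measurable_snoc).comp measurable_prodMk_left),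
    lintegral_fintype]
  refine Finset.sum_congr rfl fun k _ => ?_
  rw [take_pad]
  congr 1
  simp only [Kernel.prodMkLeft_apply]
  refine lintegral_congr fun x => ?_
  simp [pad_snoc]

/-- The arms of positive probability are the only ones selected. -/
theorem ae_act_ne_zero (π : Policy K) (F : Env K) (hK : 0 < K) (T : ℕ) :
    ∀ᵐ ω ∂(π.pathLaw F hK T), ∀ t < T, π.act t (ω.take t) {(ω t).1} ≠ 0 := by
  induction T with
  | zero => simp
  | succ T ih =>
    have hset : ∀ t, MeasurableSet {ω : Path K | π.act t (ω.take t) {(ω t).1} = 0} := by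
      intro t
      have : {ω : Path K | π.act t (ω.take t) {(ω t).1} = 0}
          = ⋃ k : Fin K, ({ω : Path K | (ω t).1 = k} ∩ {ω | π.act t (ω.take t) {k} = 0}) := by
        ext ω; simp
      rw [this]
      refine MeasurableSet.iUnion fun k => MeasurableSet.inter ?_ ?_
      · exact (measurable_fst.comp (measurable_pi_apply t)) (measurableSet_singleton k)
      · exact (((π.act t).measurable_coe (measurableSet_singleton k)).comp (measurable_take t))
          (measurableSet_singleton 0)
    have hB : MeasurableSet {ω : Path K | ∃ t < T + 1, π.act t (ω.take t) {(ω t).1} = 0} := by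
      have : {ω : Path K | ∃ t < T + 1, π.act t (ω.take t) {(ω t).1} = 0}
          = ⋃ t ∈ Finset.range (T + 1), {ω : Path K | π.act t (ω.take t) {(ω t).1} = 0} := by
        ext ω; simp
      rw [this]
      exact Finset.measurableSet_biUnion _ fun t _ => hset t
    rw [ae_iff]
    push Not
    rw [← lintegral_indicator_one hB, lintegral_pathLaw_succ π F hK T
      (measurable_one.indicator hB)]
    refine (lintegral_congr_ae ?_).trans (lintegral_zero)
    filter_upwards [ih] with ω hω
    refine Finset.sum_eq_zero fun k _ => ?_
    by_cases hk : π.act T (ω.take T) {k} = 0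
    · simp [hk]
    · have htake : ∀ t ≤ T, ∀ p, Path.take (Function.update ω T p) t = ω.take t := by
        intro t ht p
        funext s
        have : (s : ℕ) ≠ T := by omega
        simp [Path.take, this]
      have : ∀ x : ℝ, Set.indicator {ω : Path K | ∃ t < T + 1, π.act t (ω.take t) {(ω t).1} = 0}
          (1 : Path K → ENNReal) (Function.update ω T (k, x)) = 0 := by
        intro x
        refine Set.indicator_of_notMem ?_ _
        rintro ⟨t, ht, h0⟩
        rw [htake t (by omega)] at h0
        rcases Nat.lt_succ_iff_lt_or_eq.1 ht with ht | rfl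
        · rw [Function.update_of_ne ht.ne] at h0
          exact hω t ht h0
        · simp at h0
          exact hk h0
      rw [lintegral_congr this]
      simp

/-! ### The exponential supermartingale -/

/-- The deviation of the reward of round `s` from its mean. -/
def Env.noise (F : Env K) (ω : Path K) (s : ℕ) : ℝ := (ω s).2 - F.mean s (ω s).1

@[fun_prop]
theorem measurable_noise (F : Env K) (s : ℕ) : Measurable fun ω : Path K => F.noise ω s := by
  unfold Env.noise
  exact (measurable_snd.comp (measurable_pi_apply s)).sub
    ((measurable_from_top (f := F.mean s)).comp (measurable_fst.comp (measurable_pi_apply s)))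

/-- A family of sets of paths, the `s`-th of which is determined by the observations before round
`s` and the arm selected in round `s`. -/
structure Predictable (A : ℕ → Set (Path K)) : Prop where
  measurableSet : ∀ s, MeasurableSet (A s)
  congr : ∀ s (ω ω' : Path K), (∀ r < s, ω r = ω' r) → (ω s).1 = (ω' s).1 → (ω ∈ A s ↔ ω' ∈ A s)

open Classical in
-- Membership in `A s` is settled before the reward of round `s` is drawn, so given the past each
-- factor is either `1` or has mean at most `1`; the compensator `l ^ 2 / 8` is that of variance
-- proxy `1 / 4`.
theorem lintegral_exp_sum_le_one (π : Policy K) (F : Env K) (hK : 0 < K) (T : ℕ)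
    (hF : ∀ t < T, ∀ k,
      HasSubgaussianMGF (fun x : ℝ => x - F.mean t k) (1 / 4) (F t k : Measure ℝ))
    {A : ℕ → Set (Path K)} (hA : Predictable A) (l : ℝ) :
    ∫⁻ ω, ENNReal.ofReal (Real.exp (∑ s ∈ Finset.range T,
        if ω ∈ A s then l * F.noise ω s - l ^ 2 / 8 else 0)) ∂(π.pathLaw F hK T) ≤ 1 := by
  have hmeas : ∀ s, Measurable fun ω : Path K =>
      if ω ∈ A s then l * F.noise ω s - l ^ 2 / 8 else 0 := fun s =>
    Measurable.ite (hA.measurableSet s) (by fun_prop) measurable_const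
  induction T with
  | zero =>
    have := isProbabilityMeasure_pathLaw π F hK 0
    simp
  | succ T ih =>
    have := π.markov T
    rw [lintegral_pathLaw_succ π F hK T (by
      exact (Real.measurable_exp.comp (Finset.measurable_sum _ fun s _ => hmeas s)).ennreal_ofReal)]
    refine le_trans (lintegral_mono fun ω => ?_) (ih fun t ht => hF t (by omega))
    set E := ENNReal.ofReal (Real.exp (∑ s ∈ Finset.range T,
        if ω ∈ A s then l * F.noise ω s - l ^ 2 / 8 else 0)) with hE
    have hinner : ∀ k, ∫⁻ x, ENNReal.ofReal (Real.exp (∑ s ∈ Finset.range (T + 1),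
        if Function.update ω T (k, x) ∈ A s then
          l * F.noise (Function.update ω T (k, x)) s - l ^ 2 / 8 else 0)) ∂(F T k : Measure ℝ)
        ≤ E := by
      intro k
      have hold : ∀ x : ℝ, (∑ s ∈ Finset.range T,
          if Function.update ω T (k, x) ∈ A s then
            l * F.noise (Function.update ω T (k, x)) s - l ^ 2 / 8 else 0)
          = ∑ s ∈ Finset.range T, if ω ∈ A s then l * F.noise ω s - l ^ 2 / 8 else 0 := by
        intro x
        refine Finset.sum_congr rfl fun s hs => ?_
        have hs : s < T := by simpa using hs
        have h1 : Function.update ω T (k, x) ∈ A s ↔ ω ∈ A s :=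
          hA.congr s _ _ (fun r hr => Function.update_of_ne (by omega) _ _)
            (by rw [Function.update_of_ne (by omega)])
        have h2 : F.noise (Function.update ω T (k, x)) s = F.noise ω s := by
          unfold Env.noise; rw [Function.update_of_ne (by omega)]
        simp only [h1, h2]
      have hnew : ∀ x : ℝ, Function.update ω T (k, x) ∈ A T ↔ Function.update ω T (k, 0) ∈ A T :=
        fun x => hA.congr T _ _
          (fun r hr => by rw [Function.update_of_ne (by omega), Function.update_of_ne (by omega)])
          (by simp)
      simp only [Finset.sum_range_succ, hold, Real.exp_add,
        ENNReal.ofReal_mul (Real.exp_pos _).le]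
      rw [lintegral_const_mul' _ _ ENNReal.ofReal_ne_top]
      refine mul_le_of_le_one_right zero_le ?_
      simp only [hnew]
      by_cases hk : Function.update ω T (k, 0) ∈ A T
      · simp only [hk, if_true]
        have hsub := hF T (by omega) k
        have hint := hsub.integrable_exp_mul l
        have hle := hsub.mgf_le l
        have : ∀ x : ℝ, Real.exp (l * F.noise (Function.update ω T (k, x)) T - l ^ 2 / 8)
            = Real.exp (-(l ^ 2 / 8)) * Real.exp (l * (x - F.mean T k)) := by
          intro x
          rw [← Real.exp_add]
          congr 1
          simp [Env.noise]
          ring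
        simp only [this]
        rw [← ofReal_integral_eq_lintegral_ofReal (hint.const_mul _)
          (Filter.Eventually.of_forall fun x => by positivity), integral_const_mul]
        rw [← ENNReal.ofReal_one]
        refine ENNReal.ofReal_le_ofReal ?_
        unfold mgf at hle
        calc _ ≤ Real.exp (-(l ^ 2 / 8)) * Real.exp (((1 / 4 : NNReal) : ℝ) * l ^ 2 / 2) := by
              gcongr
          _ = 1 := by
              rw [← Real.exp_add, Real.exp_eq_one_iff]
              push_cast
              ring
      · simp [hk]
    calc _ ≤ ∑ k, E * π.act T (ω.take T) {k} :=
          Finset.sum_le_sum fun k _ => mul_le_mul_left (hinner k) _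
      _ = E := by
          rw [← Finset.mul_sum, sum_measure_singleton]
          simp

/-! ### Blocks of consecutive selections of an arm -/

/-- The number of selections of arm `k` in the rounds `u ≤ s < v`. -/
def pulls (k : Fin K) (u v : ℕ) (ω : Path K) : ℕ :=
  ∑ s ∈ Finset.Ico u v, if (ω s).1 = k then 1 else 0

/-- The total noise of arm `k` in the rounds `u ≤ s < v`. -/
def Env.noiseSum (F : Env K) (k : Fin K) (u v : ℕ) (ω : Path K) : ℝ :=
  ∑ s ∈ Finset.Ico u v, if (ω s).1 = k then F.noise ω s else 0

/-- Round `s` contains a selection of arm `k` which is preceded by at least `a` and by less than `b`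
selections of arm `k` since round `u`. -/
def InBlock (k : Fin K) (u a b : ℕ) (ω : Path K) (s : ℕ) : Prop :=
  (ω s).1 = k ∧ a ≤ pulls k u s ω ∧ pulls k u s ω < b

instance (k : Fin K) (u a b : ℕ) (ω : Path K) (s : ℕ) : Decidable (InBlock k u a b ω s) :=
  inferInstanceAs (Decidable (_ ∧ _ ∧ _))

/-- The total noise of the selections of arm `k` in the rounds `u ≤ s < v` whose numbers are at
least `a` and less than `b`. -/
def Env.blockNoise (F : Env K) (k : Fin K) (u v a b : ℕ) (ω : Path K) : ℝ :=
  ∑ s ∈ Finset.Ico u v, if InBlock k u a b ω s then F.noise ω s else 0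

/-- The number of the selections that contribute to `Env.blockNoise`. -/
def blockPulls (k : Fin K) (u v a b : ℕ) (ω : Path K) : ℕ :=
  ∑ s ∈ Finset.Ico u v, if InBlock k u a b ω s then 1 else 0

theorem measurableSet_arm (k : Fin K) (s : ℕ) : MeasurableSet {ω : Path K | (ω s).1 = k} :=
  (measurable_fst.comp (measurable_pi_apply s)) (measurableSet_singleton k)

@[fun_prop]
theorem measurable_pulls (k : Fin K) (u v : ℕ) : Measurable (pulls k u v) :=
  Finset.measurable_sum _ fun s _ =>
    Measurable.ite (measurableSet_arm k s) measurable_const measurable_const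

@[fun_prop]
theorem measurable_noiseSum (F : Env K) (k : Fin K) (u v : ℕ) : Measurable (F.noiseSum k u v) :=
  Finset.measurable_sum _ fun s _ =>
    Measurable.ite (measurableSet_arm k s) (measurable_noise F s) measurable_const

theorem measurableSet_inBlock (k : Fin K) (u a b s : ℕ) :
    MeasurableSet {ω : Path K | InBlock k u a b ω s} :=
  (measurableSet_arm k s).inter
    ((measurableSet_le measurable_const (measurable_pulls k u s)).inter
      (measurableSet_lt (measurable_pulls k u s) measurable_const))

@[fun_prop]
theorem measurable_blockNoise (F : Env K) (k : Fin K) (u v a b : ℕ) :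
    Measurable (F.blockNoise k u v a b) :=
  Finset.measurable_sum _ fun s _ =>
    Measurable.ite (measurableSet_inBlock k u a b s) (measurable_noise F s) measurable_const

theorem pulls_self (k : Fin K) (u : ℕ) (ω : Path K) : pulls k u u ω = 0 := by simp [pulls]

theorem pulls_succ (k : Fin K) {u v : ℕ} (h : u ≤ v) (ω : Path K) :
    pulls k u (v + 1) ω = pulls k u v ω + if (ω v).1 = k then 1 else 0 := by
  simp [pulls, Finset.sum_Ico_succ_top h]

theorem pulls_add (k : Fin K) {u v w : ℕ} (h : u ≤ v) (h' : v ≤ w) (ω : Path K) :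
    pulls k u v ω + pulls k v w ω = pulls k u w ω :=
  Finset.sum_Ico_consecutive _ h h'

theorem pulls_le (k : Fin K) (u v : ℕ) (ω : Path K) : pulls k u v ω ≤ v - u := by
  calc pulls k u v ω ≤ ∑ s ∈ Finset.Ico u v, 1 :=
        Finset.sum_le_sum fun s _ => by split_ifs <;> simp
    _ = v - u := by simp

theorem sum_pulls (u v : ℕ) (ω : Path K) : ∑ k, pulls k u v ω = v - u := by
  unfold pulls
  rw [Finset.sum_comm]
  simp

/-- A sum over the selections of an arm, in terms of their numbers. -/
theorem sum_comp_pulls {M : Type*} [AddCommMonoid M] (G : ℕ → M) (k : Fin K) {u v : ℕ}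
    (h : u ≤ v) (ω : Path K) :
    (∑ s ∈ Finset.Ico u v, if (ω s).1 = k then G (pulls k u s ω) else 0)
      = ∑ j ∈ Finset.range (pulls k u v ω), G j := by
  induction v, h using Nat.le_induction with
  | base => simp [pulls_self]
  | succ v h ih =>
    rw [Finset.sum_Ico_succ_top h, ih, pulls_succ k h]
    split_ifs <;> simp [Finset.sum_range_succ]

theorem blockPulls_eq (k : Fin K) {u v : ℕ} (h : u ≤ v) (a b : ℕ) (ω : Path K) :
    blockPulls k u v a b ω = ∑ j ∈ Finset.range (pulls k u v ω), if a ≤ j ∧ j < b then 1 else 0 := by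
  rw [← sum_comp_pulls (fun j => if a ≤ j ∧ j < b then 1 else 0) k h]
  refine Finset.sum_congr rfl fun s _ => ?_
  by_cases hk : (ω s).1 = k <;> simp [InBlock, hk]

theorem blockPulls_le (k : Fin K) {u v : ℕ} (h : u ≤ v) (a b : ℕ) (ω : Path K) :
    blockPulls k u v a b ω ≤ b - a := by
  rw [blockPulls_eq k h, Finset.sum_boole, ← Nat.card_Ico, Nat.cast_id]
  refine Finset.card_le_card fun j hj => ?_
  simp at hj ⊢
  omega

theorem not_inBlock_of_pulls_le {k : Fin K} {u v a b : ℕ} {ω : Path K} (h : pulls k u v ω ≤ a)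
    {s : ℕ} (hs : s ∈ Finset.Ico u v) : ¬ InBlock k u a b ω s := by
  rintro ⟨h1, h2, -⟩
  rw [Finset.mem_Ico] at hs
  have e := pulls_add k hs.1 (hs.2.le) ω
  have : 1 ≤ pulls k s v ω := by
    have e1 : pulls k s v ω = pulls k s (s + 1) ω + pulls k (s + 1) v ω :=
      (pulls_add k (Nat.le_succ s) hs.2 ω).symm
    rw [e1, pulls_succ k le_rfl]
    simp [h1]
    omega
  omega

theorem blockNoise_eq_zero (F : Env K) {k : Fin K} {u v a b : ℕ} {ω : Path K}
    (h : pulls k u v ω ≤ a) : F.blockNoise k u v a b ω = 0 :=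
  Finset.sum_eq_zero fun _ hs => if_neg (not_inBlock_of_pulls_le h hs)

theorem blockPulls_eq_zero {k : Fin K} {u v a b : ℕ} {ω : Path K}
    (h : pulls k u v ω ≤ a) : blockPulls k u v a b ω = 0 :=
  Finset.sum_eq_zero fun _ hs => if_neg (not_inBlock_of_pulls_le h hs)

theorem blockNoise_add (F : Env K) (k : Fin K) (u v : ℕ) {a b c : ℕ} (h : a ≤ b) (h' : b ≤ c)
    (ω : Path K) :
    F.blockNoise k u v a b ω + F.blockNoise k u v b c ω = F.blockNoise k u v a c ω := by
  unfold Env.blockNoise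
  rw [← Finset.sum_add_distrib]
  refine Finset.sum_congr rfl fun s _ => ?_
  unfold InBlock
  by_cases h1 : (ω s).1 = k
  · rcases lt_or_ge (pulls k u s ω) b with h2 | h2
    · have h3 : pulls k u s ω < c := by omega
      have h4 : ¬ b ≤ pulls k u s ω := by omega
      simp [h1, h2, h3, h4]
    · have h3 : a ≤ pulls k u s ω := by omega
      have h4 : ¬ pulls k u s ω < b := by omega
      simp [h1, h2, h3, h4]
  · simp [h1]

/-- The noise of the rounds `w ≤ s < t` is the noise of a block of selections. -/
theorem noiseSum_eq_blockNoise (F : Env K) (k : Fin K) {u w t v : ℕ} (h1 : u ≤ w) (h2 : w ≤ t)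
    (h3 : t ≤ v) (ω : Path K) :
    F.noiseSum k w t ω = F.blockNoise k u v (pulls k u w ω) (pulls k u t ω) ω := by
  unfold Env.noiseSum Env.blockNoise
  have hsub : Finset.Ico w t ⊆ Finset.Ico u v := Finset.Ico_subset_Ico h1 h3
  rw [← Finset.sum_subset hsub]
  · refine Finset.sum_congr rfl fun s hs => ?_
    rw [Finset.mem_Ico] at hs
    by_cases hk : (ω s).1 = k
    · have e1 := pulls_add k h1 hs.1 ω
      have e2 := pulls_add k (h1.trans (hs.1.trans (Nat.le_succ s))) hs.2 ω
      have e3 := pulls_succ k (h1.trans hs.1) ω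
      simp only [hk, if_true] at e3
      simp only [Nat.succ_eq_add_one] at e2
      have : InBlock k u (pulls k u w ω) (pulls k u t ω) ω s := ⟨hk, by omega, by omega⟩
      simp [hk, this]
    · have : ¬ InBlock k u (pulls k u w ω) (pulls k u t ω) ω s := fun h => hk h.1
      simp [hk, this]
  · intro s hs hs'
    refine if_neg ?_
    rintro ⟨hk, ha, hb⟩
    rw [Finset.mem_Ico] at hs hs'
    rcases lt_or_ge s w with hsw | hsw
    · have e2 := pulls_add k (hs.1.trans (Nat.le_succ s)) hsw ω
      have e3 := pulls_succ k hs.1 ω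
      simp only [hk, if_true] at e3
      simp only [Nat.succ_eq_add_one] at e2
      omega
    · have hst : t ≤ s := by omega
      have e2 := pulls_add k (h1.trans h2) hst ω
      omega

/-! ### Moments of the noise -/

/-- The sub-Gaussian hypothesis on the rewards up to the horizon `T`. -/
def Env.IsSubgaussian (F : Env K) (T : ℕ) : Prop :=
  ∀ t < T, ∀ k, HasSubgaussianMGF (fun x : ℝ => x - F.mean t k) (1 / 4) (F t k : Measure ℝ)

theorem pulls_congr {k : Fin K} {u s : ℕ} {ω ω' : Path K} (h : ∀ r < s, ω r = ω' r) :
    pulls k u s ω = pulls k u s ω' :=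
  Finset.sum_congr rfl fun r hr => by rw [h r (Finset.mem_Ico.1 hr).2]

theorem lintegral_exp_blockNoise_le_one (π : Policy K) {F : Env K} (hK : 0 < K) {T : ℕ}
    (hF : F.IsSubgaussian T) (k : Fin K) {u v : ℕ} (hv : v ≤ T) (a b : ℕ) (l : ℝ) :
    ∫⁻ ω, ENNReal.ofReal (Real.exp (l * F.blockNoise k u v a b ω
      - l ^ 2 / 8 * blockPulls k u v a b ω)) ∂(π.pathLaw F hK T) ≤ 1 := by
  classical
  have hA : Predictable (fun s => {ω : Path K | (u ≤ s ∧ s < v) ∧ InBlock k u a b ω s}) := by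
    refine ⟨fun s => (MeasurableSet.const _).inter (measurableSet_inBlock k u a b s), ?_⟩
    intro s ω ω' h h'
    simp only [Set.mem_ofPred_eq, InBlock]
    rw [h', pulls_congr h]
  refine le_of_eq_of_le (lintegral_congr fun ω => ?_)
    (lintegral_exp_sum_le_one π F hK T hF hA l)
  congr 2
  unfold Env.blockNoise blockPulls
  push_cast
  rw [Finset.mul_sum, Finset.mul_sum, ← Finset.sum_sub_distrib]
  have hsub : Finset.Ico u v ⊆ Finset.range T := fun s hs => by
    rw [Finset.mem_Ico] at hs; rw [Finset.mem_range]; omega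
  rw [← Finset.sum_subset hsub]
  · refine Finset.sum_congr rfl fun s hs => ?_
    rw [Finset.mem_Ico] at hs
    by_cases h : InBlock k u a b ω s <;> simp [h, hs]
  · intro s _ hs
    rw [Finset.mem_Ico] at hs
    simp [hs]

theorem pow_eight_le_exp_add_exp (x : ℝ) : x ^ 8 ≤ 40320 * (Real.exp x + Real.exp (-x)) := by
  have h := Real.pow_div_factorial_le_exp |x| (abs_nonneg x) 8
  have h8 : ((Nat.factorial 8 : ℕ) : ℝ) = 40320 := by norm_num [Nat.factorial]
  rw [h8, div_le_iff₀ (by norm_num)] at h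
  have e : |x| ^ 8 = x ^ 8 := Even.pow_abs (by decide) x
  have : Real.exp |x| ≤ Real.exp x + Real.exp (-x) := by
    rcases abs_cases x with ⟨h, -⟩ | ⟨h, -⟩ <;> rw [h] <;>
      linarith [Real.exp_pos x, Real.exp_pos (-x)]
  rw [e] at h
  linarith

/-- The indicator on the right is essential: only blocks that are actually reached are paid for, so
that the sum over blocks is governed by the number of selections and not by the horizon. -/
theorem lintegral_blockNoise_pow_eight_le (π : Policy K) {F : Env K} (hK : 0 < K) {T : ℕ}
    (hF : F.IsSubgaussian T) (k : Fin K) {u v : ℕ} (huv : u ≤ v) (hv : v ≤ T) (a : ℕ) {r : ℕ}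
    (hr : 0 < r) :
    ∫⁻ ω, ENNReal.ofReal (F.blockNoise k u v a (a + r) ω ^ 8) ∂(π.pathLaw F hK T)
      ≤ ∫⁻ ω, ENNReal.ofReal (161280 * (r : ℝ) ^ 4 * if a < pulls k u v ω then 1 else 0)
          ∂(π.pathLaw F hK T) := by
  have hprob := isProbabilityMeasure_pathLaw π F hK T
  set μ := π.pathLaw F hK T
  set A : Set (Path K) := {ω | a < pulls k u v ω} with hAdef
  have hA : MeasurableSet A := measurableSet_lt measurable_const (measurable_pulls k u v)
  have hr0 : (0 : ℝ) < r := by exact_mod_cast hr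
  set l : ℝ := 1 / √r with hl
  have hl2 : l ^ 2 = 1 / r := by rw [hl, div_pow, Real.sq_sqrt hr0.le, one_pow]
  -- Off `A` the block is empty and the exponential equals `1`, so subtracting the mass of `Aᶜ` from
  -- the global bound `1` leaves the mass of `A`.
  have hset : ∀ m : ℝ, ∫⁻ ω in A, ENNReal.ofReal (Real.exp (m * F.blockNoise k u v a (a + r) ω
      - m ^ 2 / 8 * blockPulls k u v a (a + r) ω)) ∂μ ≤ μ A := by
    intro m
    have h := lintegral_exp_blockNoise_le_one π hK hF k (u := u) hv a (a + r) m
    rw [← lintegral_add_compl _ hA] at h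
    have hc : ∫⁻ ω in Aᶜ, ENNReal.ofReal (Real.exp (m * F.blockNoise k u v a (a + r) ω
        - m ^ 2 / 8 * blockPulls k u v a (a + r) ω)) ∂μ = μ Aᶜ := by
      rw [← setLIntegral_one]
      refine setLIntegral_congr_fun hA.compl fun ω hω => ?_
      have hω : pulls k u v ω ≤ a := by simpa [hAdef] using hω
      simp [blockNoise_eq_zero F hω, blockPulls_eq_zero hω]
    rw [hc, ← prob_add_prob_compl (μ := μ) hA] at h
    exact (ENNReal.add_le_add_iff_right (measure_ne_top μ _)).1 h
  have hpt : ∀ ω, ENNReal.ofReal (F.blockNoise k u v a (a + r) ω ^ 8) ≤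
      A.indicator (fun ω => ENNReal.ofReal (80640 * (r : ℝ) ^ 4) *
        (ENNReal.ofReal (Real.exp (l * F.blockNoise k u v a (a + r) ω
          - l ^ 2 / 8 * blockPulls k u v a (a + r) ω)) +
        ENNReal.ofReal (Real.exp ((-l) * F.blockNoise k u v a (a + r) ω
          - (-l) ^ 2 / 8 * blockPulls k u v a (a + r) ω)))) ω := by
    intro ω
    by_cases hω : ω ∈ A
    · rw [Set.indicator_of_mem hω, ← ENNReal.ofReal_add (by positivity) (by positivity),
        ← ENNReal.ofReal_mul (by positivity)]
      refine ENNReal.ofReal_le_ofReal ?_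
      set x := F.blockNoise k u v a (a + r) ω
      have hN : (blockPulls k u v a (a + r) ω : ℝ) ≤ r := by
        have := blockPulls_le k huv a (a + r) ω
        have : blockPulls k u v a (a + r) ω ≤ r := by omega
        exact_mod_cast this
      set N : ℝ := (blockPulls k u v a (a + r) ω : ℝ)
      have h8 := pow_eight_le_exp_add_exp (l * x)
      have hx : x ^ 8 = (r : ℝ) ^ 4 * (l * x) ^ 8 := by
        have : (l * x) ^ 8 = (l ^ 2) ^ 4 * x ^ 8 := by ring
        rw [this, hl2]; field_simp
      have hlN : l ^ 2 / 8 * N ≤ 1 / 8 := by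
        rw [hl2]
        calc 1 / (r : ℝ) / 8 * N ≤ 1 / (r : ℝ) / 8 * r := by gcongr
          _ = 1 / 8 := by field_simp
      -- With `l = 1 / √r` the compensator of a block of at most `r` selections is at most `1 / 8`.
      -- Removing it costs this factor `2`, which turns `8! = 40320` into `80640`; the two signs of
      -- `l` give `161280`.
      have h2 : Real.exp (1 / 8 : ℝ) ≤ 2 := by
        have h1 := Real.exp_one_lt_d9
        have : Real.exp (1 / 8 : ℝ) ^ 8 = Real.exp 1 := by
          rw [← Real.exp_nat_mul]; norm_num
        by_contra hcon
        push Not at hcon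
        have : (2 : ℝ) ^ 8 < Real.exp (1 / 8 : ℝ) ^ 8 := by gcongr
        norm_num at this
        linarith
      have hmul : ∀ y : ℝ, Real.exp y ≤ 2 * Real.exp (y - l ^ 2 / 8 * N) := by
        intro y
        calc Real.exp y = Real.exp (l ^ 2 / 8 * N) * Real.exp (y - l ^ 2 / 8 * N) := by
              rw [← Real.exp_add]; ring_nf
          _ ≤ 2 * Real.exp (y - l ^ 2 / 8 * N) := by
              gcongr
              exact (Real.exp_le_exp.2 hlN).trans h2
      have e1 := hmul (l * x)
      have e2 := hmul (-(l * x))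
      have e3 : (-l) * x = -(l * x) := by ring
      rw [hx, neg_sq, e3]
      calc (r : ℝ) ^ 4 * (l * x) ^ 8
          ≤ (r : ℝ) ^ 4 * (40320 * (2 * Real.exp (l * x - l ^ 2 / 8 * N)
              + 2 * Real.exp (-(l * x) - l ^ 2 / 8 * N))) := by
            gcongr
            linarith
        _ = _ := by ring
    · rw [Set.indicator_of_notMem hω]
      have hω : pulls k u v ω ≤ a := by simpa [hAdef] using hω
      simp [blockNoise_eq_zero F hω]
  refine (lintegral_mono hpt).trans ?_
  rw [lintegral_indicator hA, lintegral_const_mul' _ _ ENNReal.ofReal_ne_top,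
    lintegral_add_left']
  swap
  · have : Measurable (blockPulls k u v a (a + r)) := Finset.measurable_sum _ fun s _ =>
      Measurable.ite (measurableSet_inBlock k u a (a + r) s) measurable_const measurable_const
    fun_prop
  have hright : ∫⁻ ω, ENNReal.ofReal (161280 * (r : ℝ) ^ 4 * if a < pulls k u v ω then 1 else 0) ∂μ
      = ENNReal.ofReal (161280 * (r : ℝ) ^ 4) * μ A := by
    rw [← lintegral_indicator_const hA]
    refine lintegral_congr fun ω => ?_
    by_cases hω : a < pulls k u v ω
    · rw [Set.indicator_of_mem (show ω ∈ A from hω)]; simp [hω]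
    · rw [Set.indicator_of_notMem (show ω ∉ A from hω)]; simp [hω]
  rw [hright]
  calc _ ≤ ENNReal.ofReal (80640 * (r : ℝ) ^ 4) * (μ A + μ A) := by
        gcongr
        · exact hset l
        · exact hset (-l)
    _ = ENNReal.ofReal (161280 * (r : ℝ) ^ 4) * μ A := by
        rw [← two_mul, ← mul_assoc, ← ENNReal.ofReal_ofNat, ← ENNReal.ofReal_mul (by positivity)]
        congr 2
        ring

theorem lintegral_ofReal_sum_mono {α ι : Type*} [MeasurableSpace α] {μ : Measure α} (s : Finset ι)
    (c : ι → ℝ) (f g : ι → α → ℝ) (hc : ∀ i ∈ s, 0 ≤ c i) (hf : ∀ i, Measurable (f i))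
    (hg : ∀ i, Measurable (g i)) (hf0 : ∀ i x, 0 ≤ f i x) (hg0 : ∀ i x, 0 ≤ g i x)
    (h : ∀ i ∈ s, ∫⁻ x, ENNReal.ofReal (f i x) ∂μ ≤ ∫⁻ x, ENNReal.ofReal (g i x) ∂μ) :
    ∫⁻ x, ENNReal.ofReal (∑ i ∈ s, c i * f i x) ∂μ
      ≤ ∫⁻ x, ENNReal.ofReal (∑ i ∈ s, c i * g i x) ∂μ := by
  have key : ∀ (q : ι → α → ℝ), (∀ i, Measurable (q i)) → (∀ i x, 0 ≤ q i x) →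
      ∫⁻ x, ENNReal.ofReal (∑ i ∈ s, c i * q i x) ∂μ
        = ∑ i ∈ s, ENNReal.ofReal (c i) * ∫⁻ x, ENNReal.ofReal (q i x) ∂μ := by
    intro q hq hq0
    have e : ∀ x, ENNReal.ofReal (∑ i ∈ s, c i * q i x)
        = ∑ i ∈ s, ENNReal.ofReal (c i) * ENNReal.ofReal (q i x) := by
      intro x
      rw [ENNReal.ofReal_sum_of_nonneg fun i hi => mul_nonneg (hc i hi) (hq0 i x)]
      exact Finset.sum_congr rfl fun i hi => ENNReal.ofReal_mul (hc i hi)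
    simp only [e]
    rw [lintegral_finsetSum _ fun i _ => (hq i).ennreal_ofReal.const_mul _]
    exact Finset.sum_congr rfl fun i _ => lintegral_const_mul' _ _ ENNReal.ofReal_ne_top
  rw [key f hf hf0, key g hg hg0]
  exact Finset.sum_le_sum fun i hi => mul_le_mul_right (h i hi) _

/-! ### The chaining energy of an arm -/

/-- The weight of the dyadic scale `z` in `Env.chainEnergy`. -/
def chainWeight (z : ℝ) : ℝ := min (1 / z ^ 2) (1 / z ^ 6)

theorem chainWeight_pos {z : ℝ} (hz : 0 < z) : 0 < chainWeight z :=
  lt_min (by positivity) (by positivity)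

/-- At scale `z = r / H` a reached block has eighth moment of order `z ^ 4 H ^ 4`, and at most `L /
r + 1` blocks are reached by `L` selections. This produces `z ^ 3 (L / H) + z ^ 4`, and the weight
makes both powers summable over dyadic `z` in both directions. -/
theorem chainWeight_mul_le {z : ℝ} (hz : 0 < z) :
    chainWeight z * z ^ 3 ≤ min z (1 / z) ∧ chainWeight z * z ^ 4 ≤ min z (1 / z) := by
  have h2 : chainWeight z ≤ 1 / z ^ 2 := min_le_left _ _
  have h6 : chainWeight z ≤ 1 / z ^ 6 := min_le_right _ _
  rcases le_total z 1 with h | h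
  · have hmin : min z (1 / z) = z := min_eq_left (by
      rw [le_div_iff₀ hz]; nlinarith)
    rw [hmin]
    constructor
    · calc chainWeight z * z ^ 3 ≤ 1 / z ^ 2 * z ^ 3 := by gcongr
        _ = z := by field_simp
    · calc chainWeight z * z ^ 4 ≤ 1 / z ^ 2 * z ^ 4 := by gcongr
        _ = z * z := by field_simp
        _ ≤ z := by nlinarith
  · have hmin : min z (1 / z) = 1 / z := min_eq_right (by
      rw [div_le_iff₀ hz]; nlinarith)
    rw [hmin]
    constructor
    · calc chainWeight z * z ^ 3 ≤ 1 / z ^ 6 * z ^ 3 := by gcongr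
        _ = 1 / z ^ 3 := by field_simp
        _ ≤ 1 / z := by
          gcongr
          exact le_self_pow₀ h (by norm_num)
    · calc chainWeight z * z ^ 4 ≤ 1 / z ^ 6 * z ^ 4 := by gcongr
        _ = 1 / z ^ 2 := by field_simp
        _ ≤ 1 / z := by
          gcongr
          exact le_self_pow₀ h (by norm_num)

/-- A weighted sum of the eighth powers of the noise in all dyadic blocks of selections of arm `k`
in the rounds `u ≤ s < v`, normalized for blocks of length about `H`. -/
def Env.chainEnergy (F : Env K) (k : Fin K) (u v : ℕ) (H : ℝ) (ω : Path K) : ℝ :=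
  ∑ p ∈ Finset.range v ×ˢ Finset.range v, chainWeight (2 ^ p.1 / H) / H ^ 4 *
    F.blockNoise k u v (p.2 * 2 ^ p.1) (p.2 * 2 ^ p.1 + 2 ^ p.1) ω ^ 8

theorem chainEnergy_nonneg (F : Env K) (k : Fin K) (u v : ℕ) {H : ℝ} (hH : 0 < H) (ω : Path K) :
    0 ≤ F.chainEnergy k u v H ω :=
  Finset.sum_nonneg fun _ _ => mul_nonneg
    (div_nonneg (chainWeight_pos (by positivity)).le (by positivity))
    (Even.pow_nonneg (by decide) _)

@[fun_prop]
theorem measurable_chainEnergy (F : Env K) (k : Fin K) (u v : ℕ) (H : ℝ) :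
    Measurable (F.chainEnergy k u v H) :=
  Finset.measurable_sum _ fun _ _ => ((measurable_blockNoise F k u v _ _).pow_const 8).const_mul _

theorem sum_ite_mul_lt_le (v L : ℕ) {r : ℕ} (hr : 0 < r) :
    (∑ i ∈ Finset.range v, if i * r < L then (1 : ℝ) else 0) ≤ L / r + 1 := by
  rw [Finset.sum_boole]
  have h : (Finset.range v).filter (fun i => i * r < L) ⊆ Finset.range (L / r + 1) := by
    intro i hi
    simp only [Finset.mem_filter, Finset.mem_range] at hi ⊢
    have := (Nat.le_div_iff_mul_le hr).2 hi.2.le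
    omega
  have hc := Finset.card_le_card h
  rw [Finset.card_range] at hc
  calc (((Finset.range v).filter (fun i => i * r < L)).card : ℝ) ≤ ((L / r + 1 : ℕ) : ℝ) := by
        exact_mod_cast hc
    _ ≤ L / r + 1 := by
        push_cast
        gcongr
        exact Nat.cast_div_le

theorem lintegral_chainEnergy_le (π : Policy K) {F : Env K} (hK : 0 < K) {T : ℕ}
    (hF : F.IsSubgaussian T) (k : Fin K) {u v : ℕ} (huv : u ≤ v) (hv : v ≤ T) {H : ℝ}
    (hH : 0 < H) :
    ∫⁻ ω, ENNReal.ofReal (F.chainEnergy k u v H ω) ∂(π.pathLaw F hK T)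
      ≤ ∫⁻ ω, ENNReal.ofReal (1290240 * (1 + pulls k u v ω / H)) ∂(π.pathLaw F hK T) := by
  have hm : ∀ a : ℕ, Measurable fun ω : Path K => if a < pulls k u v ω then (1 : ℝ) else 0 :=
    fun a => Measurable.ite (measurableSet_lt measurable_const (measurable_pulls k u v))
      measurable_const measurable_const
  refine (lintegral_ofReal_sum_mono _ _ _
    (fun p ω => 161280 * ((2 ^ p.1 : ℕ) : ℝ) ^ 4 *
      if p.2 * 2 ^ p.1 < pulls k u v ω then (1 : ℝ) else 0)
    (fun p _ => div_nonneg (chainWeight_pos (by positivity)).le (by positivity))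
    (fun p => (measurable_blockNoise F k u v _ _).pow_const 8)
    (fun p => (hm _).const_mul _)
    (fun p ω => Even.pow_nonneg (by decide) _)
    (fun p ω => by positivity)
    (fun p _ => lintegral_blockNoise_pow_eight_le π hK hF k huv hv _ (by positivity))).trans ?_
  refine lintegral_mono fun ω => ENNReal.ofReal_le_ofReal ?_
  set L := pulls k u v ω
  rw [Finset.sum_product]
  have hterm : ∀ j ∈ Finset.range v, ∑ i ∈ Finset.range v,
      chainWeight (2 ^ j / H) / H ^ 4 * (161280 * ((2 ^ j : ℕ) : ℝ) ^ 4 *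
        if i * 2 ^ j < L then (1 : ℝ) else 0)
      ≤ 161280 * (1 + L / H) * min (1 / H * 2 ^ j) (1 / (1 / H * 2 ^ j)) := by
    intro j _
    have hz : (0 : ℝ) < 2 ^ j / H := by positivity
    obtain ⟨h3, h4⟩ := chainWeight_mul_le hz
    have hw := chainWeight_pos hz
    have hsum := sum_ite_mul_lt_le v L (r := 2 ^ j) (by positivity)
    have ez : (1 : ℝ) / H * 2 ^ j = 2 ^ j / H := by ring
    rw [ez]
    set z : ℝ := 2 ^ j / H with hzdef
    have hr : ((2 ^ j : ℕ) : ℝ) = z * H := by rw [hzdef]; push_cast; field_simp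
    simp only [← mul_assoc]
    rw [← Finset.mul_sum]
    rw [hr] at hsum ⊢
    calc chainWeight z / H ^ 4 * 161280 * (z * H) ^ 4 *
          ∑ i ∈ Finset.range v, (if i * 2 ^ j < L then (1 : ℝ) else 0)
        ≤ chainWeight z / H ^ 4 * 161280 * (z * H) ^ 4 * (L / (z * H) + 1) := by gcongr
      _ = 161280 * (chainWeight z * z ^ 3 * (L / H) + chainWeight z * z ^ 4) := by
          field_simp
      _ ≤ 161280 * (min z (1 / z) * (L / H) + min z (1 / z)) := by gcongr
      _ = 161280 * (1 + L / H) * min z (1 / z) := by ring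
  refine (Finset.sum_le_sum hterm).trans ?_
  rw [← Finset.mul_sum]
  -- The geometric bound is `8` for ratio `2`, and `8 * 161280 = 1290240`.
  have hg := sum_min_geom_le (ρ := 2) (y := 1 / H) (by norm_num) (by positivity) v
  calc _ ≤ 161280 * (1 + L / H) * (4 * 2 / (2 - 1)) := by gcongr
    _ = _ := by ring

/-! ### Underestimation of a fixed arm -/

/-- The exploration bonus of an arm with `n` samples. -/
def bonus (η H n : ℝ) : ℝ := √(η * (max (Real.log (H / n)) 0 / n))

/-- The amount by which the index of arm `k`, computed from the rounds `u ≤ s < t`, falls below the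
average of the means of the samples. -/
def Env.shortfall (F : Env K) (η H : ℝ) (k : Fin K) (u t : ℕ) (ω : Path K) : ℝ :=
  if pulls k u t ω = 0 then 0
  else max 0 (-(F.noiseSum k u t ω / pulls k u t ω + bonus η H (pulls k u t ω)))

theorem shortfall_nonneg (F : Env K) (η H : ℝ) (k : Fin K) (u t : ℕ) (ω : Path K) :
    0 ≤ F.shortfall η H k u t ω := by
  unfold Env.shortfall
  split_ifs
  · exact le_rfl
  · exact le_max_left _ _

@[fun_prop]
theorem measurable_shortfall (F : Env K) (η H : ℝ) (k : Fin K) (u t : ℕ) :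
    Measurable (F.shortfall η H k u t) := by
  have h1 := measurable_pulls k u t
  have h2 := measurable_noiseSum F k u t
  have h3 : Measurable fun ω => ((pulls k u t ω : ℕ) : ℝ) := by fun_prop
  refine Measurable.ite (h1 (measurableSet_singleton 0)) measurable_const ?_
  refine measurable_const.max ((h2.div h3).add ?_).neg
  have h4 : Measurable fun n : ℕ => bonus η H n := measurable_from_top
  exact h4.comp h1

theorem bonus_antitone {η H m n : ℝ} (hη : 0 ≤ η) (hH : 0 < H) (hm : 0 < m) (hmn : m ≤ n) :
    bonus η H n ≤ bonus η H m := by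
  have hn : 0 < n := hm.trans_le hmn
  unfold bonus
  gcongr

theorem lintegral_exp_noiseSum_le_one (π : Policy K) {F : Env K} (hK : 0 < K) {T : ℕ}
    (hF : F.IsSubgaussian T) (k : Fin K) {u t : ℕ} (ht : t ≤ T) (l : ℝ) :
    ∫⁻ ω, ENNReal.ofReal (Real.exp (l * F.noiseSum k u t ω - l ^ 2 / 8 * pulls k u t ω))
      ∂(π.pathLaw F hK T) ≤ 1 := by
  refine le_of_eq_of_le (lintegral_congr fun ω => ?_)
    (lintegral_exp_blockNoise_le_one π hK hF k (u := u) ht 0 (t + 1) l)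
  have h1 : ∀ s ∈ Finset.Ico u t, (InBlock k u 0 (t + 1) ω s ↔ (ω s).1 = k) := by
    intro s hs
    have := pulls_le k u s ω
    rw [Finset.mem_Ico] at hs
    exact ⟨fun h => h.1, fun h => ⟨h, Nat.zero_le _, by omega⟩⟩
  have e1 : F.noiseSum k u t ω = F.blockNoise k u t 0 (t + 1) ω :=
    Finset.sum_congr rfl fun s hs => by simp only [h1 s hs]
  have e2 : pulls k u t ω = blockPulls k u t 0 (t + 1) ω :=
    Finset.sum_congr rfl fun s hs => by simp only [h1 s hs]
  rw [e1, e2]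

/-- Put `z = r / H`. The exponential is `min 1 ((2 z) ^ η)` and `1 / √r = z ^ (-1/2) / √H`. For `z ≤
1` the product decays like `z ^ (η - 1/2)` as `z` tends to `0`, which is where `η > 1 / 2` enters;
for `z ≥ 1` the factor `z ^ (-1/2)` suffices. -/
theorem exp_neg_bonus_le {η H r δ : ℝ} (hδ : 0 < δ) (hδ2 : δ ≤ 1 / 2) (hδη : δ + 1 / 2 ≤ η)
    (hH : 0 < H) (hr : 0 < r) :
    1 / √r * Real.exp (-(2 * r * bonus η H (2 * r) ^ 2))
      ≤ 2 / √H * min ((r / H) ^ δ) (1 / (r / H) ^ δ) := by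
  have hη : 0 < η := by linarith
  set z := r / H with hz
  have hz0 : 0 < z := by positivity
  have hb : 2 * r * bonus η H (2 * r) ^ 2 = η * max (Real.log (H / (2 * r))) 0 := by
    unfold bonus
    rw [Real.sq_sqrt (by positivity)]
    field_simp
  rw [hb]
  have hsr : 1 / √r = 1 / √H * (1 / z ^ (1 / 2 : ℝ)) := by
    rw [← Real.sqrt_eq_rpow, hz, Real.sqrt_div hr.le]
    have : 0 < √H := by positivity
    have : 0 < √r := by positivity
    field_simp
  rw [hsr, mul_assoc, div_eq_mul_one_div 2 (√H), mul_comm 2 (1 / √H), mul_assoc]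
  refine mul_le_mul_of_nonneg_left ?_ (by positivity)
  have hmax : 0 ≤ max (Real.log (H / (2 * r))) 0 := le_max_right _ _
  rcases le_total z 1 with h | h
  · have hmin : min (z ^ δ) (1 / z ^ δ) = z ^ δ := by
      have h1 : z ^ δ ≤ 1 := Real.rpow_le_one hz0.le h hδ.le
      have h0 : 0 < z ^ δ := by positivity
      refine min_eq_left ?_
      rw [le_div_iff₀ h0]; nlinarith
    rw [hmin]
    have hexp : Real.exp (-(η * max (Real.log (H / (2 * r))) 0)) ≤ (2 * z) ^ (δ + 1 / 2) := by
      rw [Real.rpow_def_of_pos (by positivity)]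
      refine Real.exp_le_exp.2 ?_
      have e : Real.log (2 * z) = -Real.log (H / (2 * r)) := by
        rw [← Real.log_inv]; congr 1; rw [hz]; field_simp
      rw [e]
      have h1 : (δ + 1 / 2) * max (Real.log (H / (2 * r))) 0
          ≤ η * max (Real.log (H / (2 * r))) 0 := by gcongr
      have h2 : (δ + 1 / 2) * Real.log (H / (2 * r))
          ≤ (δ + 1 / 2) * max (Real.log (H / (2 * r))) 0 := by
        gcongr; exact le_max_left _ _
      nlinarith
    calc 1 / z ^ (1 / 2 : ℝ) * Real.exp (-(η * max (Real.log (H / (2 * r))) 0))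
        ≤ 1 / z ^ (1 / 2 : ℝ) * (2 * z) ^ (δ + 1 / 2) := by gcongr
      _ = 2 ^ (δ + 1 / 2) * z ^ δ := by
          rw [Real.mul_rpow (by norm_num) hz0.le, Real.rpow_add hz0 δ]
          have : 0 < z ^ (1 / 2 : ℝ) := by positivity
          field_simp
      _ ≤ 2 ^ (1 : ℝ) * z ^ δ := by
          gcongr
          · norm_num
          · linarith
      _ = 2 * z ^ δ := by rw [Real.rpow_one]
  · have hle : z ^ δ ≤ z ^ (1 / 2 : ℝ) := Real.rpow_le_rpow_of_exponent_le h hδ2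
    have hmin : min (z ^ δ) (1 / z ^ δ) = 1 / z ^ δ := by
      have h1 : 1 ≤ z ^ δ := Real.one_le_rpow h hδ.le
      refine min_eq_right ?_
      rw [div_le_iff₀ (by positivity)]; nlinarith
    rw [hmin]
    have hexp : Real.exp (-(η * max (Real.log (H / (2 * r))) 0)) ≤ 1 :=
      Real.exp_le_one_iff.2 (by nlinarith [mul_nonneg hη.le hmax])
    have h0 : 0 < z ^ δ := by positivity
    calc 1 / z ^ (1 / 2 : ℝ) * Real.exp (-(η * max (Real.log (H / (2 * r))) 0))
        ≤ 1 / z ^ δ * 1 := by gcongr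
      _ ≤ 2 * (1 / z ^ δ) := by
        have : 0 < 1 / z ^ δ := by positivity
        linarith

/-- The shortfall of an arm whose number of samples is between `r` and `2 * r`, in terms of an
exponential of the noise. -/
theorem neg_noise_add_bonus_le {η H r S n : ℝ} (hη : 0 ≤ η) (hH : 0 < H) (hr : 0 < r) (hn : r ≤ n)
    (hn2 : n ≤ 2 * r) :
    max 0 (-(S / n + bonus η H n)) ≤
      2 * (1 / √r * Real.exp (-(2 * r * bonus η H (2 * r) ^ 2))) *
        Real.exp (-(4 * bonus η H (2 * r) + 1 / √r) * S
          - (-(4 * bonus η H (2 * r) + 1 / √r)) ^ 2 / 8 * n) := by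
  have hn0 : 0 < n := hr.trans_le hn
  have hb : bonus η H (2 * r) ≤ bonus η H n := bonus_antitone hη hH hn0 hn2
  have hb0 : 0 ≤ bonus η H (2 * r) := Real.sqrt_nonneg _
  set β := bonus η H (2 * r)
  -- The value `4 * β` maximizes `l * β - l ^ 2 / 8`. The extra `1 / √r` keeps `l` away from zero
  -- when the bonus vanishes and lowers the exponent by at most `1 / 4`.
  set l := 4 * β + 1 / √r with hl
  have hs : 0 < √r := by positivity
  have hs2 : √r ^ 2 = r := Real.sq_sqrt hr.le
  have hl0 : 0 < l := by positivity
  refine max_le (by positivity) ?_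
  have h1 : -(S / n + bonus η H n) ≤ (-S - n * β) / n := by
    rw [sub_div, mul_div_cancel_left₀ _ hn0.ne', neg_div]; linarith
  have h2 : (-S - n * β) ≤ Real.exp (l * (-S - n * β)) / l := by
    rw [le_div_iff₀ hl0]
    have := Real.add_one_le_exp (l * (-S - n * β))
    linarith [mul_comm l (-S - n * β)]
  have h3 : Real.exp (l * (-S - n * β)) / l / n ≤ 1 / √r * Real.exp (l * (-S - n * β)) := by
    rw [div_div, div_eq_mul_inv, mul_comm, ← one_div]
    have : √r ≤ l * n := by
      calc √r = 1 / √r * r := by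
            rw [one_div, inv_mul_eq_div, Real.div_sqrt]
        _ ≤ l * n := by
            gcongr
            linarith
    gcongr
  have h4 : l * (-S - n * β) ≤ 1 / 4 + (-(2 * r * β ^ 2) + (-l * S - (-l) ^ 2 / 8 * n)) := by
    have e : l * (-S - n * β) = -l * S - (-l) ^ 2 / 8 * n - n * (l * β - l ^ 2 / 8) := by ring
    have e2 : l * β - l ^ 2 / 8 = 2 * β ^ 2 - 1 / (8 * r) := by
      have hi : 1 / (8 * r) = (1 / √r) ^ 2 / 8 := by rw [div_pow, hs2]; field_simp
      rw [hl, hi]; ring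
    rw [e, e2]
    have h5 : n * (1 / (8 * r)) ≤ 1 / 4 := by
      calc n * (1 / (8 * r)) ≤ 2 * r * (1 / (8 * r)) := by gcongr
        _ = 1 / 4 := by field_simp; norm_num
    have h6 : r * (2 * β ^ 2) ≤ n * (2 * β ^ 2) := by gcongr
    nlinarith
  have h7 : Real.exp (1 / 4 : ℝ) ≤ 2 := by
    have h1 := Real.exp_one_lt_d9
    have : Real.exp (1 / 4 : ℝ) ^ 4 = Real.exp 1 := by
      rw [← Real.exp_nat_mul]; norm_num
    by_contra hcon
    push Not at hcon
    have : (2 : ℝ) ^ 4 < Real.exp (1 / 4 : ℝ) ^ 4 := by gcongr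
    norm_num at this
    linarith
  calc -(S / n + bonus η H n) ≤ (-S - n * β) / n := h1
    _ ≤ Real.exp (l * (-S - n * β)) / l / n := by gcongr
    _ ≤ 1 / √r * Real.exp (l * (-S - n * β)) := h3
    _ ≤ 1 / √r * Real.exp (1 / 4 + (-(2 * r * β ^ 2) + (-l * S - (-l) ^ 2 / 8 * n))) := by gcongr
    _ = Real.exp (1 / 4) * (1 / √r * Real.exp (-(2 * r * β ^ 2))
          * Real.exp (-l * S - (-l) ^ 2 / 8 * n)) := by
        rw [Real.exp_add, Real.exp_add]; ring
    _ ≤ 2 * (1 / √r * Real.exp (-(2 * r * β ^ 2))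
          * Real.exp (-l * S - (-l) ^ 2 / 8 * n)) := by gcongr
    _ = _ := by ring

/-- For each number of samples one dyadic scale dominates the shortfall by an exponential of the
noise with fixed parameter. Summing over all scales removes the dependence on the random number;
each exponential has mean at most `1`, and the coefficients sum to order `1 / √H`. -/
theorem exists_lintegral_shortfall_le {η : ℝ} (hη : 1 / 2 < η) :
    ∃ C : ℝ, 0 ≤ C ∧ ∀ {K : ℕ} (π : Policy K) {F : Env K} (hK : 0 < K) {T : ℕ},
      F.IsSubgaussian T → ∀ (k : Fin K) {u t : ℕ}, t ≤ T → ∀ {H : ℝ}, 0 < H →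
      ∫⁻ ω, ENNReal.ofReal (F.shortfall η H k u t ω) ∂(π.pathLaw F hK T)
        ≤ ENNReal.ofReal (C / √H) := by
  set δ := min (η - 1 / 2) (1 / 2) with hδ
  have hδ0 : 0 < δ := lt_min (by linarith) (by norm_num)
  have hδ2 : δ ≤ 1 / 2 := min_le_right _ _
  have hδη : δ + 1 / 2 ≤ η := by have := min_le_left (η - 1 / 2) (1 / 2); linarith
  have hρ : (1 : ℝ) < 2 ^ δ := Real.one_lt_rpow (by norm_num) hδ0
  refine ⟨4 * (4 * 2 ^ δ / (2 ^ δ - 1)), ?_, ?_⟩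
  · have : (0 : ℝ) < 2 ^ δ - 1 := by linarith
    positivity
  intro K π F hK T hF k u t ht H hH
  set c : ℕ → ℝ := fun i =>
    2 * (1 / √(2 ^ i : ℝ) * Real.exp (-(2 * 2 ^ i * bonus η H (2 * 2 ^ i) ^ 2))) with hc
  have hc0 : ∀ i, 0 ≤ c i := fun i => by positivity
  set l : ℕ → ℝ := fun i => -(4 * bonus η H (2 * 2 ^ i) + 1 / √(2 ^ i : ℝ)) with hl
  have hpt : ∀ ω, ENNReal.ofReal (F.shortfall η H k u t ω) ≤ ∑ i ∈ Finset.range (t + 1),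
      ENNReal.ofReal (c i) * ENNReal.ofReal (Real.exp (l i * F.noiseSum k u t ω
        - l i ^ 2 / 8 * pulls k u t ω)) := by
    intro ω
    unfold Env.shortfall
    split_ifs with h0
    · simp
    set n := pulls k u t ω with hn
    have hnt : n ≤ t := (pulls_le k u t ω).trans (Nat.sub_le _ _)
    have hlow : 2 ^ Nat.log 2 n ≤ n := Nat.pow_log_le_self 2 h0
    have hup : n < 2 ^ (Nat.log 2 n + 1) := Nat.lt_pow_succ_log_self (by norm_num) n
    have hlog : Nat.log 2 n < n := Nat.log_lt_self 2 h0
    refine le_trans ?_ (Finset.single_le_sum (f := fun i => ENNReal.ofReal (c i) *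
      ENNReal.ofReal (Real.exp (l i * F.noiseSum k u t ω - l i ^ 2 / 8 * n)))
      (fun _ _ => zero_le) (Finset.mem_range.2 (by omega : Nat.log 2 n < t + 1)))
    rw [← ENNReal.ofReal_mul (hc0 _)]
    refine ENNReal.ofReal_le_ofReal ?_
    refine neg_noise_add_bonus_le (by linarith) hH (by positivity) ?_ ?_
    · exact_mod_cast hlow
    · rw [pow_succ, mul_comm] at hup
      exact_mod_cast hup.le
  refine (lintegral_mono hpt).trans ?_
  rw [lintegral_finsetSum _ fun i _ => by fun_prop]
  have hsum : ∑ i ∈ Finset.range (t + 1), c i ≤ 4 * (4 * 2 ^ δ / (2 ^ δ - 1)) / √H := by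
    have hterm : ∀ i ∈ Finset.range (t + 1), c i ≤
        4 / √H * min ((1 / H) ^ δ * (2 ^ δ) ^ i) (1 / ((1 / H) ^ δ * (2 ^ δ) ^ i)) := by
      intro i _
      have h := exp_neg_bonus_le hδ0 hδ2 hδη hH (r := 2 ^ i) (by positivity)
      have e : ((2 : ℝ) ^ i / H) ^ δ = (1 / H) ^ δ * (2 ^ δ) ^ i := by
        rw [div_eq_mul_one_div, Real.mul_rpow (by positivity) (by positivity),
          ← Real.rpow_natCast, ← Real.rpow_natCast, ← Real.rpow_mul (by norm_num),
          ← Real.rpow_mul (by norm_num), mul_comm (i : ℝ), mul_comm]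
      rw [e] at h
      simp only [hc]
      calc _ ≤ 2 * (2 / √H * min ((1 / H) ^ δ * (2 ^ δ) ^ i)
            (1 / ((1 / H) ^ δ * (2 ^ δ) ^ i))) := by gcongr
        _ = _ := by ring
    refine (Finset.sum_le_sum hterm).trans ?_
    rw [← Finset.mul_sum]
    have := sum_min_geom_le hρ (y := (1 / H) ^ δ) (by positivity) (t + 1)
    calc _ ≤ 4 / √H * (4 * 2 ^ δ / (2 ^ δ - 1)) := by gcongr
      _ = _ := by ring
  calc _ ≤ ∑ i ∈ Finset.range (t + 1), ENNReal.ofReal (c i) := by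
        refine Finset.sum_le_sum fun i _ => ?_
        rw [lintegral_const_mul' _ _ ENNReal.ofReal_ne_top]
        exact mul_le_of_le_one_right zero_le
          (lintegral_exp_noiseSum_le_one π hK hF k ht (l i))
    _ = ENNReal.ofReal (∑ i ∈ Finset.range (t + 1), c i) :=
        (ENNReal.ofReal_sum_of_nonneg fun i _ => hc0 i).symm
    _ ≤ _ := ENNReal.ofReal_le_ofReal hsum

/-! ### The noise of the selected arms -/

/-- The constant in the chaining bound `abs_noiseSum_le`. -/
def chainConst : ℝ :=
  2 * (2 ^ (1 / 4 : ℝ) / (2 ^ (1 / 4 : ℝ) - 1) + 2 ^ (3 / 4 : ℝ) / (2 ^ (3 / 4 : ℝ) - 1))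

theorem sum_dyadic_rpow_le {H p : ℝ} (hH : 0 < H) (hp : 0 < p) {n : ℕ} (hn : n ≠ 0) :
    ∑ j ∈ Finset.range (Nat.log 2 n + 1), ((2 : ℝ) ^ j / H) ^ p
      ≤ 2 ^ p / (2 ^ p - 1) * (n / H) ^ p := by
  have hx : (1 : ℝ) < 2 ^ p := Real.one_lt_rpow (by norm_num) hp
  have hx1 : (0 : ℝ) < 2 ^ p - 1 := by linarith
  have e : ∀ j : ℕ, ((2 : ℝ) ^ j / H) ^ p = (2 ^ p) ^ j / H ^ p := by
    intro j
    rw [Real.div_rpow (by positivity) hH.le, ← Real.rpow_natCast, ← Real.rpow_natCast,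
      ← Real.rpow_mul (by norm_num), ← Real.rpow_mul (by norm_num), mul_comm]
  simp only [e]
  rw [← Finset.sum_div]
  have hlow : (2 : ℝ) ^ Nat.log 2 n ≤ n := by exact_mod_cast Nat.pow_log_le_self 2 hn
  calc (∑ j ∈ Finset.range (Nat.log 2 n + 1), ((2 : ℝ) ^ p) ^ j) / H ^ p
      ≤ (2 ^ p / (2 ^ p - 1) * (2 ^ p) ^ Nat.log 2 n) / H ^ p := by
        gcongr
        exact sum_geom_le hx _
    _ = 2 ^ p / (2 ^ p - 1) * ((2 : ℝ) ^ Nat.log 2 n / H) ^ p := by rw [e, mul_div_assoc]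
    _ ≤ 2 ^ p / (2 ^ p - 1) * (n / H) ^ p := by gcongr

/-- The eighth root of the inverse weight is `max (z ^ (1/4)) (z ^ (3/4))`: the exponents `2` and
`6` in `chainWeight` are `8 / 4` and `8 * 3 / 4`. -/
theorem abs_le_of_chainWeight_mul_le {X Q H z : ℝ} (hQ : 0 ≤ Q) (hH : 0 < H) (hz0 : 0 < z)
    (hle : chainWeight z / H ^ 4 * X ^ 8 ≤ Q) :
    |X| ≤ √H * Q ^ (1 / 8 : ℝ) * (z ^ (1 / 4 : ℝ) + z ^ (3 / 4 : ℝ)) := by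
  set y := z ^ (1 / 4 : ℝ) with hy
  have hy0 : 0 < y := by positivity
  have hy4 : y ^ 4 = z := by
    rw [hy, ← Real.rpow_natCast, ← Real.rpow_mul hz0.le]; norm_num
  have hy3 : z ^ (3 / 4 : ℝ) = y ^ 3 := rpow_mul_nat hz0.le _ _ 3 (by norm_num)
  rw [hy3]
  have hq8 : (Q ^ (1 / 8 : ℝ)) ^ 8 = Q := by
    rw [← Real.rpow_natCast, ← Real.rpow_mul hQ]; norm_num
  have hs8 : √H ^ 8 = H ^ 4 := by
    rw [show 8 = 2 * 4 from rfl, pow_mul, Real.sq_sqrt hH.le]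
  refine le_of_pow_le_pow_left₀ (n := 8) (by norm_num) (by positivity) ?_
  rw [Even.pow_abs (by decide), mul_pow, mul_pow, hq8, hs8]
  have hX : X ^ 8 ≤ H ^ 4 * Q * (1 / chainWeight z) := by
    have hw := chainWeight_pos hz0
    rw [div_mul_eq_mul_div, div_le_iff₀ (by positivity)] at hle
    rw [mul_one_div, le_div_iff₀ hw]
    linarith
  refine hX.trans ?_
  gcongr
  unfold chainWeight
  rcases min_choice (1 / z ^ 2) (1 / z ^ 6) with h | h <;> rw [h, one_div_one_div, ← hy4]
  · calc (y ^ 4) ^ 2 = y ^ 8 := by ring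
      _ ≤ (y + y ^ 3) ^ 8 := by gcongr; linarith [pow_pos hy0 3]
  · calc (y ^ 4) ^ 6 = (y ^ 3) ^ 8 := by ring
      _ ≤ (y + y ^ 3) ^ 8 := by gcongr; linarith

theorem abs_blockNoise_dyadic_le (F : Env K) (k : Fin K) {u v : ℕ} {H : ℝ} (hH : 0 < H)
    (ω : Path K) {j : ℕ} (hj : j < v) (i : ℕ) :
    |F.blockNoise k u v (i * 2 ^ j) (i * 2 ^ j + 2 ^ j) ω|
      ≤ √H * F.chainEnergy k u v H ω ^ (1 / 8 : ℝ)
        * ((2 ^ j / H) ^ (1 / 4 : ℝ) + (2 ^ j / H) ^ (3 / 4 : ℝ)) := by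
  have hQ := chainEnergy_nonneg F k u v hH ω
  by_cases hi : i < v
  · refine abs_le_of_chainWeight_mul_le hQ hH (by positivity) ?_
    have hmem : (j, i) ∈ Finset.range v ×ˢ Finset.range v :=
      Finset.mem_product.2 ⟨Finset.mem_range.2 hj, Finset.mem_range.2 hi⟩
    have hnn : ∀ p ∈ Finset.range v ×ˢ Finset.range v, 0 ≤ chainWeight (2 ^ p.1 / H) / H ^ 4 *
        F.blockNoise k u v (p.2 * 2 ^ p.1) (p.2 * 2 ^ p.1 + 2 ^ p.1) ω ^ 8 := fun p _ =>
      mul_nonneg (div_nonneg (chainWeight_pos (by positivity)).le (by positivity))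
        (Even.pow_nonneg (by decide) _)
    have h := Finset.single_le_sum hnn hmem
    dsimp only at h
    unfold Env.chainEnergy
    exact h
  -- Blocks outside the finite index set of the energy start after the last selection and carry no
  -- noise.
  · have hp : pulls k u v ω ≤ i * 2 ^ j := by
      have h1 := pulls_le k u v ω
      have h2 : i * 1 ≤ i * 2 ^ j := Nat.mul_le_mul_left _ Nat.one_le_two_pow
      omega
    rw [blockNoise_eq_zero F hp, abs_zero]
    positivity

/-- Counted in selections since `u`, the window is an interval of length `n`, and chaining uses only
dyadic blocks of length at most `n`. Their bounds grow geometrically with the scale, so the largest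
scale dominates. One energy serves all windows within `[u, v)`. -/
theorem abs_noiseSum_le (F : Env K) (k : Fin K) {u w t v : ℕ} (h1 : u ≤ w) (h2 : w ≤ t)
    (h3 : t ≤ v) {H : ℝ} (hH : 0 < H) (ω : Path K) (hn : pulls k w t ω ≠ 0) :
    |F.noiseSum k w t ω| ≤ chainConst * (√H * F.chainEnergy k u v H ω ^ (1 / 8 : ℝ)) *
      ((pulls k w t ω / H) ^ (1 / 4 : ℝ) + (pulls k w t ω / H) ^ (3 / 4 : ℝ)) := by
  have hQ := chainEnergy_nonneg F k u v hH ω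
  set n := pulls k w t ω with hndef
  have hadd := pulls_add k h1 h2 ω
  have hnv : n ≤ v := by
    have := pulls_le k w t ω
    omega
  have hlog : Nat.log 2 n < n := Nat.log_lt_self 2 hn
  set f : ℕ → ℝ := fun m => F.blockNoise k u v 0 m ω with hf
  have hfsub : ∀ a b, a ≤ b → f b - f a = F.blockNoise k u v a b ω := fun a b hab => by
    have := blockNoise_add F k u v (Nat.zero_le a) hab ω
    simp only [hf]; linarith
  set B := √H * F.chainEnergy k u v H ω ^ (1 / 8 : ℝ) with hB
  have hB0 : 0 ≤ B := by positivity
  have hch := abs_sub_le_dyadic (Nat.log 2 n + 1) f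
    (fun j => B * (((2 : ℝ) ^ j / H) ^ (1 / 4 : ℝ) + ((2 : ℝ) ^ j / H) ^ (3 / 4 : ℝ)))
    (fun j hj i => by
      have e : (i + 1) * 2 ^ j = i * 2 ^ j + 2 ^ j := by ring
      rw [e, hfsub _ _ (Nat.le_add_right _ _)]
      exact abs_blockNoise_dyadic_le F k hH ω (by omega) i)
    (pulls k u w ω) (pulls k u t ω) (by omega) (by
      have : pulls k u t ω - pulls k u w ω = n := by omega
      rw [this]
      exact Nat.lt_pow_succ_log_self (by norm_num) n)
  rw [hfsub _ _ (by omega), ← noiseSum_eq_blockNoise F k h1 h2 h3] at hch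
  refine hch.trans ?_
  rw [← Finset.mul_sum, Finset.sum_add_distrib]
  have s1 := sum_dyadic_rpow_le hH (by norm_num : (0 : ℝ) < 1 / 4) hn
  have s2 := sum_dyadic_rpow_le hH (by norm_num : (0 : ℝ) < 3 / 4) hn
  set c1 : ℝ := 2 ^ (1 / 4 : ℝ) / (2 ^ (1 / 4 : ℝ) - 1) with hc1
  set c2 : ℝ := 2 ^ (3 / 4 : ℝ) / (2 ^ (3 / 4 : ℝ) - 1) with hc2
  have g1 : (1 : ℝ) < 2 ^ (1 / 4 : ℝ) := Real.one_lt_rpow (by norm_num) (by norm_num)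
  have g2 : (1 : ℝ) < 2 ^ (3 / 4 : ℝ) := Real.one_lt_rpow (by norm_num) (by norm_num)
  have hc10 : 0 ≤ c1 := div_nonneg (by positivity) (by linarith)
  have hc20 : 0 ≤ c2 := div_nonneg (by positivity) (by linarith)
  have hcc : chainConst = 2 * (c1 + c2) := rfl
  rw [hcc]
  set p : ℝ := ((n : ℝ) / H) ^ (1 / 4 : ℝ)
  set q : ℝ := ((n : ℝ) / H) ^ (3 / 4 : ℝ)
  have hp : 0 ≤ p := by positivity
  have hq : 0 ≤ q := by positivity
  calc _ ≤ 2 * (B * (c1 * p + c2 * q)) := by gcongr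
    _ ≤ 2 * (B * ((c1 + c2) * (p + q))) := by
        gcongr
        nlinarith [mul_nonneg hc10 hq, mul_nonneg hc20 hp]
    _ = _ := by ring

theorem chainConst_nonneg : 0 ≤ chainConst := by
  have g1 : (1 : ℝ) < 2 ^ (1 / 4 : ℝ) := Real.one_lt_rpow (by norm_num) (by norm_num)
  have g2 : (1 : ℝ) < 2 ^ (3 / 4 : ℝ) := Real.one_lt_rpow (by norm_num) (by norm_num)
  have hc10 : (0 : ℝ) ≤ 2 ^ (1 / 4 : ℝ) / (2 ^ (1 / 4 : ℝ) - 1) :=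
    div_nonneg (by positivity) (by linarith)
  have hc20 : (0 : ℝ) ≤ 2 ^ (3 / 4 : ℝ) / (2 ^ (3 / 4 : ℝ) - 1) :=
    div_nonneg (by positivity) (by linarith)
  unfold chainConst
  linarith

/-- Bounding the logarithm by a square root, `log (H / n) ≤ 2 √(H / n)`, gives the bonus the shape
of the first term of the noise bound divided by `n`, so both are summed together. -/
theorem bonus_le {η H n : ℝ} (hη : 0 ≤ η) (hH : 0 < H) (hn : 0 < n) :
    bonus η H n ≤ √(2 * η) * √H * (n / H) ^ (1 / 4 : ℝ) / n := by
  set y := (n / H) ^ (1 / 4 : ℝ) with hy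
  have hy0 : 0 < y := by positivity
  have hy4 : y ^ 4 = n / H := by
    rw [hy, ← Real.rpow_natCast, ← Real.rpow_mul (by positivity)]; norm_num
  have hnH : n = H * y ^ 4 := by rw [hy4]; field_simp
  refine Real.sqrt_le_iff.2 ⟨by positivity, ?_⟩
  have hlog : max (Real.log (H / n)) 0 ≤ 2 * (1 / y ^ 2) := by
    refine max_le ?_ (by positivity)
    have e : H / n = (1 / y ^ 2) ^ 2 := by rw [hnH]; field_simp
    rw [e, Real.log_pow]
    have := Real.log_le_sub_one_of_pos (by positivity : (0 : ℝ) < 1 / y ^ 2)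
    push_cast
    linarith
  rw [div_pow, mul_pow, mul_pow, Real.sq_sqrt (by positivity), Real.sq_sqrt hH.le]
  calc η * (max (Real.log (H / n)) 0 / n) ≤ η * (2 * (1 / y ^ 2) / n) := by gcongr
    _ = 2 * η * H * y ^ 2 / n ^ 2 := by
        rw [hnH]; field_simp

/-- The noise and the bonus of an arm selected for the `j + 1`-st time. -/
theorem rpow_div_le {H A n : ℝ} {j : ℕ} (hH : 0 < H) (hA : 0 ≤ A) (hn : (j + 1 : ℝ) / 2 ≤ n) :
    A * ((n / H) ^ (1 / 4 : ℝ) + (n / H) ^ (3 / 4 : ℝ)) / n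
      ≤ 2 * A * ((H ^ (1 / 4 : ℝ))⁻¹ * ((j + 1 : ℝ) ^ (3 / 4 : ℝ))⁻¹
        + (H ^ (3 / 4 : ℝ))⁻¹ * ((j + 1 : ℝ) ^ (1 / 4 : ℝ))⁻¹) := by
  have hj : (0 : ℝ) < j + 1 := by positivity
  have hn0 : 0 < n := by linarith [half_pos hj]
  have key : ∀ p : ℝ, 0 ≤ p → p ≤ 1 → (n ^ p)⁻¹ ≤ 2 * ((j + 1 : ℝ) ^ p)⁻¹ := by
    intro p hp hp1
    have h1 : (j + 1 : ℝ) ^ p ≤ 2 * n ^ p := by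
      calc (j + 1 : ℝ) ^ p ≤ (2 * n) ^ p := by gcongr; linarith
        _ = 2 ^ p * n ^ p := Real.mul_rpow (by norm_num) hn0.le
        _ ≤ 2 ^ (1 : ℝ) * n ^ p := by
            gcongr
            norm_num
        _ = 2 * n ^ p := by rw [Real.rpow_one]
    have h2 : 0 < n ^ p := by positivity
    have h3 : 0 < (j + 1 : ℝ) ^ p := by positivity
    rw [← div_eq_mul_inv, inv_eq_one_div, div_le_div_iff₀ h2 h3]
    linarith
  have e : ∀ p q : ℝ, p + q = 1 → (n / H) ^ p / n = (H ^ p)⁻¹ * (n ^ q)⁻¹ := by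
    intro p q hpq
    rw [Real.div_rpow hn0.le hH.le]
    have h1 : n = n ^ p * n ^ q := by rw [← Real.rpow_add hn0, hpq, Real.rpow_one]
    have h2 : 0 < n ^ p := by positivity
    have h3 : 0 < n ^ q := by positivity
    have h4 : 0 < H ^ p := by positivity
    rw [show n ^ p / H ^ p / n = n ^ p / H ^ p / (n ^ p * n ^ q) by rw [← h1]]
    field_simp
  rw [mul_div_assoc, add_div, e (1 / 4) (3 / 4) (by norm_num), e (3 / 4) (1 / 4) (by norm_num)]
  have k1 := key (3 / 4) (by norm_num) (by norm_num)
  have k2 := key (1 / 4) (by norm_num) (by norm_num)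
  calc _ ≤ A * ((H ^ (1 / 4 : ℝ))⁻¹ * (2 * ((j + 1 : ℝ) ^ (3 / 4 : ℝ))⁻¹)
        + (H ^ (3 / 4 : ℝ))⁻¹ * (2 * ((j + 1 : ℝ) ^ (1 / 4 : ℝ))⁻¹)) := by gcongr
    _ = _ := by ring

/-- The overestimation of the selected arm `k`, computed from the rounds `u ≤ s < t`. -/
def Env.excess (F : Env K) (η H : ℝ) (k : Fin K) (u t : ℕ) (ω : Path K) : ℝ :=
  if pulls k u t ω = 0 then 0
  else |F.noiseSum k u t ω| / pulls k u t ω + bonus η H (pulls k u t ω)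

theorem excess_nonneg (F : Env K) (η H : ℝ) (k : Fin K) (u t : ℕ) (ω : Path K) :
    0 ≤ F.excess η H k u t ω := by
  unfold Env.excess
  split_ifs
  · exact le_rfl
  · exact add_nonneg (by positivity) (Real.sqrt_nonneg _)

/-- As the interval has length at most `τ`, each window contains all earlier selections of the
interval. The excess at the successive selections thus decays like the powers `-3/4` and `-1/4` of
their number, and summation produces powers of `N / H`. -/
theorem sum_excess_le (F : Env K) {η H : ℝ} (hη : 0 ≤ η) (hH : 0 < H) (k : Fin K) {τ w v : ℕ}
    (hwv : w ≤ v) (hv : v ≤ w + τ) (ω : Path K) :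
    (∑ t ∈ Finset.Ico w v, if (ω t).1 = k then F.excess η H k (t - τ) t ω else 0)
      ≤ 16 * (chainConst + √(2 * η)) *
        (√H * (1 + F.chainEnergy k (w - τ) v H ω + pulls k w v ω / H)) := by
  have hQ := chainEnergy_nonneg F k (w - τ) v hH ω
  set Q := F.chainEnergy k (w - τ) v H ω with hQdef
  have hcc := chainConst_nonneg
  set A := √H * (chainConst * Q ^ (1 / 8 : ℝ) + √(2 * η)) with hA
  have hA0 : 0 ≤ A := by positivity
  set G : ℕ → ℝ := fun j => 2 * A * ((H ^ (1 / 4 : ℝ))⁻¹ * ((j + 1 : ℝ) ^ (3 / 4 : ℝ))⁻¹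
        + (H ^ (3 / 4 : ℝ))⁻¹ * ((j + 1 : ℝ) ^ (1 / 4 : ℝ))⁻¹) with hG
  have hG0 : ∀ j, 0 ≤ G j := fun j => by positivity
  have hpt : ∀ t ∈ Finset.Ico w v,
      (if (ω t).1 = k then F.excess η H k (t - τ) t ω else 0)
        ≤ if (ω t).1 = k then G (pulls k w t ω) else 0 := by
    intro t ht
    rw [Finset.mem_Ico] at ht
    split_ifs
    swap
    · exact le_rfl
    unfold Env.excess
    split_ifs with h0
    · exact hG0 _
    have hadd := pulls_add k (by omega : t - τ ≤ w) ht.1 ω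
    -- With `j` earlier selections in the interval, the window has at least `max 1 j` samples, hence
    -- at least `(j + 1) / 2`.
    have hnj : ((pulls k w t ω : ℝ) + 1) / 2 ≤ pulls k (t - τ) t ω := by
      have : pulls k w t ω + 1 ≤ 2 * pulls k (t - τ) t ω := by omega
      have : ((pulls k w t ω + 1 : ℕ) : ℝ) ≤ ((2 * pulls k (t - τ) t ω : ℕ) : ℝ) := by
        exact_mod_cast this
      push_cast at this
      linarith
    have hS := abs_noiseSum_le F k (by omega : w - τ ≤ t - τ) (Nat.sub_le t τ) ht.2.le hH ω h0
    have hn0 : (0 : ℝ) < pulls k (t - τ) t ω := by exact_mod_cast Nat.pos_of_ne_zero h0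
    have hb := bonus_le hη hH hn0
    rw [← hQdef] at hS
    set n : ℝ := (pulls k (t - τ) t ω : ℝ)
    refine le_trans ?_ (rpow_div_le hH hA0 hnj)
    set p := (n / H) ^ (1 / 4 : ℝ)
    set q := (n / H) ^ (3 / 4 : ℝ)
    have hp : 0 ≤ p := by positivity
    have hq : 0 ≤ q := by positivity
    calc |F.noiseSum k (t - τ) t ω| / n + bonus η H n
        ≤ chainConst * (√H * Q ^ (1 / 8 : ℝ)) * (p + q) / n + √(2 * η) * √H * p / n := by
          gcongr
      _ = (chainConst * (√H * Q ^ (1 / 8 : ℝ)) * (p + q) + √(2 * η) * √H * p) / n := by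
          rw [add_div]
      _ ≤ A * (p + q) / n := by
          gcongr
          have : 0 ≤ √(2 * η) * √H * q := by positivity
          rw [hA]
          nlinarith
  refine (Finset.sum_le_sum hpt).trans ?_
  rw [sum_comp_pulls G k hwv]
  set N := pulls k w v ω
  simp only [hG]
  rw [← Finset.mul_sum, Finset.sum_add_distrib, ← Finset.mul_sum, ← Finset.mul_sum]
  have s1 := sum_rpow_neg_three_quarters_le N
  have s2 := sum_rpow_neg_quarter_le N
  set x : ℝ := N / H with hx
  have hx0 : 0 ≤ x := by positivity
  have e : ∀ p : ℝ, (H ^ p)⁻¹ * (4 * (N : ℝ) ^ p) = 4 * x ^ p := by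
    intro p
    rw [hx, Real.div_rpow (by positivity) hH.le]; ring
  -- The eighth root leaves room for Young's inequality: `1/8 + 3/4 ≤ 1`. The outcome is linear in
  -- the energy and in the selections, so only first moments are needed.
  have y1 := rpow_mul_rpow_le_one_add hQ hx0 (by norm_num : (0 : ℝ) ≤ 1 / 8)
    (by norm_num : (0 : ℝ) ≤ 1 / 4) (by norm_num)
  have y2 := rpow_mul_rpow_le_one_add hQ hx0 (by norm_num : (0 : ℝ) ≤ 1 / 8)
    (by norm_num : (0 : ℝ) ≤ 3 / 4) (by norm_num)
  have y3 := rpow_mul_rpow_le_one_add hQ hx0 (le_refl (0 : ℝ))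
    (by norm_num : (0 : ℝ) ≤ 1 / 4) (by norm_num)
  have y4 := rpow_mul_rpow_le_one_add hQ hx0 (le_refl (0 : ℝ))
    (by norm_num : (0 : ℝ) ≤ 3 / 4) (by norm_num)
  rw [Real.rpow_zero, one_mul] at y3 y4
  calc _ ≤ 2 * A * ((H ^ (1 / 4 : ℝ))⁻¹ * (4 * (N : ℝ) ^ (1 / 4 : ℝ))
        + (H ^ (3 / 4 : ℝ))⁻¹ * (4 * (N : ℝ) ^ (3 / 4 : ℝ))) := by gcongr
    _ = 8 * √H * (chainConst * (Q ^ (1 / 8 : ℝ) * x ^ (1 / 4 : ℝ) + Q ^ (1 / 8 : ℝ) * x ^ (3 / 4 : ℝ))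
          + √(2 * η) * (x ^ (1 / 4 : ℝ) + x ^ (3 / 4 : ℝ))) := by rw [e, e, hA]; ring
    _ ≤ 8 * √H * (chainConst * ((1 + Q + x) + (1 + Q + x))
          + √(2 * η) * ((1 + Q + x) + (1 + Q + x))) := by gcongr
    _ = _ := by ring

/-- In a time interval of length at most `τ`, an arm is selected at most once without a sample in
the window. -/
theorem sum_no_sample_le_one (k : Fin K) {τ w v : ℕ} (hwv : w ≤ v) (hv : v ≤ w + τ) (ω : Path K) :
    (∑ t ∈ Finset.Ico w v, if (ω t).1 = k then
      (if pulls k (t - τ) t ω = 0 then (1 : ℝ) else 0) else 0) ≤ 1 := by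
  calc _ ≤ ∑ t ∈ Finset.Ico w v, if (ω t).1 = k then
        (fun j => if j = 0 then (1 : ℝ) else 0) (pulls k w t ω) else 0 := by
        refine Finset.sum_le_sum fun t ht => ?_
        rw [Finset.mem_Ico] at ht
        have hadd := pulls_add k (by omega : t - τ ≤ w) ht.1 ω
        split_ifs with h1 h2
        · have h3 : pulls k w t ω = 0 := by omega
          simp [h3]
        · positivity
        · exact le_rfl
    _ = ∑ j ∈ Finset.range (pulls k w v ω), if j = 0 then (1 : ℝ) else 0 :=
        sum_comp_pulls (fun j => if j = 0 then (1 : ℝ) else 0) k hwv ω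
    _ ≤ 1 := by
        rw [Finset.sum_ite_eq']
        split_ifs <;> norm_num

/-! ### The regret of a single round -/

theorem sum_windowPicks {M : Type*} [AddCommMonoid M] (τ t : ℕ) (ω : Path K) (k : Fin K)
    (g : ℕ → M) :
    ∑ s ∈ windowPicks τ (ω.take t) k, g s
      = ∑ s ∈ Finset.Ico (t - τ) t, if (ω s).1 = k then g s else 0 := by
  unfold windowPicks
  rw [Finset.sum_filter]
  have h1 := Fin.sum_univ_eq_sum_range
    (fun s => if t ≤ s + τ ∧ (ω s).1 = k then g s else 0) t
  refine h1.trans ?_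
  have hsub : Finset.Ico (t - τ) t ⊆ Finset.range t := fun s hs => by
    rw [Finset.mem_Ico] at hs; rw [Finset.mem_range]; omega
  rw [← Finset.sum_subset hsub]
  · refine Finset.sum_congr rfl fun s hs => ?_
    rw [Finset.mem_Ico] at hs
    have : t ≤ s + τ := by omega
    simp [this]
  · intro s hs hs'
    rw [Finset.mem_range] at hs
    rw [Finset.mem_Ico] at hs'
    have : ¬ t ≤ s + τ := by omega
    simp [this]

theorem card_windowPicks (τ t : ℕ) (ω : Path K) (k : Fin K) :
    (windowPicks τ (ω.take t) k).card = pulls k (t - τ) t ω := by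
  rw [Finset.card_eq_sum_ones]
  exact sum_windowPicks τ t ω k fun _ => 1

theorem swIndex_take (η : ℝ) (τ t : ℕ) (ω : Path K) (k : Fin K) :
    swIndex η τ (ω.take t) k = if pulls k (t - τ) t ω = 0 then ⊤ else
      (((∑ s ∈ Finset.Ico (t - τ) t, if (ω s).1 = k then (ω s).2 else 0) / pulls k (t - τ) t ω
        + bonus η (τ / K) (pulls k (t - τ) t ω) : ℝ) : EReal) := by
  unfold swIndex
  simp only [card_windowPicks]
  rw [← sum_windowPicks τ t ω k fun s => (ω s).2]
  simp only [bonus, div_div]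
  rfl

/-- The variation of the mean rewards within the window of round `t`. -/
def Env.drift (F : Env K) (τ t : ℕ) : ℝ :=
  ∑ s ∈ Finset.Ico (t - τ) t, ⨆ k, |F.mean (s + 1) k - F.mean s k|

theorem drift_nonneg (F : Env K) (τ t : ℕ) : 0 ≤ F.drift τ t :=
  Finset.sum_nonneg fun _ _ => Real.iSup_nonneg fun _ => abs_nonneg _

theorem abs_mean_sub_mean_le_drift (F : Env K) (k : Fin K) {τ t s : ℕ}
    (hs : s ∈ Finset.Ico (t - τ) t) : |F.mean s k - F.mean t k| ≤ F.drift τ t := by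
  rw [Finset.mem_Ico] at hs
  calc |F.mean s k - F.mean t k| = |∑ r ∈ Finset.Ico s t, (F.mean (r + 1) k - F.mean r k)| := by
        rw [Finset.sum_Ico_sub (fun r => F.mean r k) hs.2.le, abs_sub_comm]
    _ ≤ ∑ r ∈ Finset.Ico s t, |F.mean (r + 1) k - F.mean r k| := Finset.abs_sum_le_sum_abs _ _
    _ ≤ ∑ r ∈ Finset.Ico s t, ⨆ k, |F.mean (r + 1) k - F.mean r k| :=
        Finset.sum_le_sum fun r _ =>
          le_ciSup (f := fun k => |F.mean (r + 1) k - F.mean r k|) (Set.finite_range _).bddAbove k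
    _ ≤ F.drift τ t :=
        Finset.sum_le_sum_of_subset_of_nonneg (Finset.Ico_subset_Ico hs.1 le_rfl)
          fun _ _ _ => Real.iSup_nonneg fun _ => abs_nonneg _

/-- Exchange the sums: the change of the means between two consecutive rounds lies in the windows of
at most `τ` rounds. -/
theorem sum_drift_le (F : Env K) (τ T : ℕ) :
    ∑ t ∈ Finset.range T, F.drift τ t ≤ τ * F.variation T := by
  unfold Env.variation
  set d : ℕ → ℝ := fun s => ⨆ k, |F.mean (s + 1) k - F.mean s k| with hd
  have hd0 : ∀ s, 0 ≤ d s := fun s => Real.iSup_nonneg fun _ => abs_nonneg _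
  have h1 : ∀ t ∈ Finset.range T, F.drift τ t
      = ∑ s ∈ Finset.range (T - 1), if t ≤ s + τ ∧ s < t then d s else 0 := by
    intro t ht
    rw [Finset.mem_range] at ht
    have hsub : Finset.Ico (t - τ) t ⊆ Finset.range (T - 1) := fun s hs => by
      rw [Finset.mem_Ico] at hs; rw [Finset.mem_range]; omega
    rw [← Finset.sum_subset hsub]
    · refine Finset.sum_congr rfl fun s hs => ?_
      rw [Finset.mem_Ico] at hs
      exact (if_pos ⟨by omega, hs.2⟩).symm
    · intro s _ hs'
      rw [Finset.mem_Ico] at hs'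
      exact if_neg (by omega)
  rw [Finset.sum_congr rfl h1, Finset.sum_comm, Finset.mul_sum]
  refine Finset.sum_le_sum fun s _ => ?_
  rw [← Finset.sum_filter, Finset.sum_const, nsmul_eq_mul]
  refine mul_le_mul_of_nonneg_right ?_ (hd0 s)
  have : (Finset.range T).filter (fun t => t ≤ s + τ ∧ s < t) ⊆ Finset.Ioc s (s + τ) := by
    intro t ht
    simp only [Finset.mem_filter] at ht
    rw [Finset.mem_Ioc]
    exact ⟨ht.2.2, ht.2.1⟩
  have hc := Finset.card_le_card this
  rw [Nat.card_Ioc] at hc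
  exact_mod_cast hc.trans (by omega)

/-- The average of the samples of arm `k` in the window. -/
theorem abs_average_sub_le (F : Env K) (k : Fin K) (τ t : ℕ) (ω : Path K)
    (hn : pulls k (t - τ) t ω ≠ 0) :
    |(∑ s ∈ Finset.Ico (t - τ) t, if (ω s).1 = k then (ω s).2 else 0) / pulls k (t - τ) t ω
      - F.noiseSum k (t - τ) t ω / pulls k (t - τ) t ω - F.mean t k| ≤ F.drift τ t := by
  have hn0 : (0 : ℝ) < pulls k (t - τ) t ω := by exact_mod_cast Nat.pos_of_ne_zero hn
  have hcast : (pulls k (t - τ) t ω : ℝ)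
      = ∑ s ∈ Finset.Ico (t - τ) t, if (ω s).1 = k then (1 : ℝ) else 0 := by
    unfold pulls; push_cast; rfl
  have e : (∑ s ∈ Finset.Ico (t - τ) t, if (ω s).1 = k then (ω s).2 else 0) / pulls k (t - τ) t ω
      - F.noiseSum k (t - τ) t ω / pulls k (t - τ) t ω - F.mean t k
      = (∑ s ∈ Finset.Ico (t - τ) t, if (ω s).1 = k then F.mean s k - F.mean t k else 0)
        / pulls k (t - τ) t ω := by
    rw [← sub_div, sub_eq_iff_eq_add, eq_comm, div_add' _ _ _ hn0.ne']
    congr 1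
    unfold Env.noiseSum
    rw [hcast, Finset.mul_sum, ← Finset.sum_add_distrib, ← Finset.sum_sub_distrib]
    refine Finset.sum_congr rfl fun s _ => ?_
    by_cases h : (ω s).1 = k
    · simp [h, Env.noise]
    · simp [h]
  rw [e, abs_div, abs_of_pos hn0, div_le_iff₀ hn0, hcast, Finset.mul_sum]
  refine (Finset.abs_sum_le_sum_abs _ _).trans (Finset.sum_le_sum fun s hs => ?_)
  split_ifs
  · simpa using abs_mean_sub_mean_le_drift F k hs
  · simp

theorem exists_mean_eq_bestMean (F : Env K) (hK : 0 < K) (t : ℕ) :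
    ∃ k, F.mean t k = F.bestMean t := by
  have : Nonempty (Fin K) := ⟨⟨0, hK⟩⟩
  exact exists_eq_ciSup_of_finite

/-- An arm of maximal mean reward in round `t`. -/
def Env.bestArm (F : Env K) (hK : 0 < K) (t : ℕ) : Fin K :=
  (exists_mean_eq_bestMean F hK t).choose

theorem mean_bestArm (F : Env K) (hK : 0 < K) (t : ℕ) :
    F.mean t (F.bestArm hK t) = F.bestMean t :=
  (exists_mean_eq_bestMean F hK t).choose_spec

theorem mean_le_bestMean (F : Env K) (t : ℕ) (k : Fin K) : F.mean t k ≤ F.bestMean t :=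
  le_ciSup (f := fun k => F.mean t k) (Set.finite_range _).bddAbove k

theorem bestMean_sub_mean_le {F : Env K} {η b : ℝ} (hK : 0 < K) {τ t : ℕ} {ω : Path K}
    (hb : F.bestMean t - F.mean t (ω t).1 ≤ b)
    (hω : ∀ j, swIndex η τ (ω.take t) j ≤ swIndex η τ (ω.take t) (ω t).1) :
    F.bestMean t - F.mean t (ω t).1 ≤
      b * (if pulls (ω t).1 (t - τ) t ω = 0 then 1 else 0) + 2 * F.drift τ t
        + F.shortfall η (τ / K) (F.bestArm hK t) (t - τ) t ω
        + F.excess η (τ / K) (ω t).1 (t - τ) t ω := by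
  have hd := drift_nonneg F τ t
  have hs := shortfall_nonneg F η (τ / K) (F.bestArm hK t) (t - τ) t ω
  have hx := excess_nonneg F η (τ / K) (ω t).1 (t - τ) t ω
  by_cases h0 : pulls (ω t).1 (t - τ) t ω = 0
  · simp only [h0, if_true, mul_one]
    linarith
  have hj := hω (F.bestArm hK t)
  rw [swIndex_take, swIndex_take, if_neg h0] at hj
  -- An arm without a sample has infinite index and would beat the selected arm, whose index is
  -- finite.
  have hj0 : pulls (F.bestArm hK t) (t - τ) t ω ≠ 0 := by
    intro h
    rw [if_pos h, top_le_iff] at hj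
    exact EReal.coe_ne_top _ hj
  rw [if_neg hj0, EReal.coe_le_coe_iff] at hj
  have a1 := abs_le.1 (abs_average_sub_le F _ τ t ω h0)
  have a2 := abs_le.1 (abs_average_sub_le F _ τ t ω hj0)
  rw [mean_bestArm] at a2
  simp only [h0, if_false, mul_zero, zero_add]
  unfold Env.shortfall Env.excess
  rw [if_neg h0, if_neg hj0]
  have m1 := le_max_right 0 (-(F.noiseSum (F.bestArm hK t) (t - τ) t ω /
    pulls (F.bestArm hK t) (t - τ) t ω + bonus η (τ / K) (pulls (F.bestArm hK t) (t - τ) t ω)))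
  have m2 : F.noiseSum (ω t).1 (t - τ) t ω / pulls (ω t).1 (t - τ) t ω
      ≤ |F.noiseSum (ω t).1 (t - τ) t ω| / pulls (ω t).1 (t - τ) t ω := by
    gcongr; exact le_abs_self _
  linarith [a1.1, a1.2, a2.1, a2.2]

/-! ### The regret over the horizon -/

theorem sum_range_eq_sum_epochs {M : Type*} [AddCommMonoid M] (f : ℕ → M) (τ T n : ℕ) :
    ∑ i ∈ Finset.range n, ∑ t ∈ Finset.Ico (min (i * τ) T) (min ((i + 1) * τ) T), f t
      = ∑ t ∈ Finset.range (min (n * τ) T), f t := by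
  induction n with
  | zero => simp
  | succ n ih =>
    rw [Finset.sum_range_succ, ih, Finset.range_eq_Ico, Finset.range_eq_Ico,
      Finset.sum_Ico_consecutive _ (Nat.zero_le _)]
    have : n * τ ≤ (n + 1) * τ := Nat.mul_le_mul_right _ (Nat.le_succ n)
    omega

/-- A sum over all rounds, by epochs of length `τ` and selected arms. -/
theorem sum_arm_eq_sum_epochs (g : Fin K → ℕ → ℝ) {τ : ℕ} (hτ : 0 < τ) (T : ℕ) (ω : Path K) :
    ∑ t ∈ Finset.range T, g (ω t).1 t
      = ∑ i ∈ Finset.range (T / τ + 1), ∑ k,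
          ∑ t ∈ Finset.Ico (min (i * τ) T) (min ((i + 1) * τ) T),
            if (ω t).1 = k then g k t else 0 := by
  have h : min ((T / τ + 1) * τ) T = T := by
    have := Nat.lt_div_mul_add hτ (a := T)
    rw [Nat.add_mul, one_mul]
    omega
  have h2 := sum_range_eq_sum_epochs (fun t => g (ω t).1 t) τ T (T / τ + 1)
  rw [h] at h2
  rw [← h2]
  refine Finset.sum_congr rfl fun i _ => ?_
  rw [Finset.sum_comm]
  refine Finset.sum_congr rfl fun t _ => ?_
  simp

theorem sum_regret_le {F : Env K} {η V a b : ℝ} (hη : 0 ≤ η) (hb : 0 < b) (hK : 0 < K) {τ T : ℕ}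
    (hτ : 0 < τ) (hF : F ∈ envClass K T V a b) {ω : Path K}
    (hω : ∀ t < T, K ≤ t → ∀ j, swIndex η τ (ω.take t) j ≤ swIndex η τ (ω.take t) (ω t).1) :
    ∑ t ∈ Finset.range T, (F.bestMean t - F.mean t (ω t).1) ≤
      b * K + b * ((T / τ + 1 : ℕ) * K) + 2 * (τ * V)
        + ∑ t ∈ Finset.range T, F.shortfall η (τ / K) (F.bestArm hK t) (t - τ) t ω
        + ∑ i ∈ Finset.range (T / τ + 1), 16 * (chainConst + √(2 * η)) * (√(τ / K) *
          (2 * K + ∑ k, F.chainEnergy k (min (i * τ) T - τ) (min ((i + 1) * τ) T) (τ / K) ω)) := by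
  have hK0 : (0 : ℝ) < K := by exact_mod_cast hK
  have hτ0 : (0 : ℝ) < τ := by exact_mod_cast hτ
  have hH : (0 : ℝ) < τ / K := by positivity
  set H : ℝ := τ / K with hHdef
  have hmono : ∀ i, min (i * τ) T ≤ min ((i + 1) * τ) T ∧
      min ((i + 1) * τ) T ≤ min (i * τ) T + τ := by
    intro i
    rw [Nat.add_mul, one_mul]
    omega
  have hround : ∀ t ∈ Finset.range T, F.bestMean t - F.mean t (ω t).1 ≤
      b * (if t < K then 1 else 0)
        + b * (if pulls (ω t).1 (t - τ) t ω = 0 then 1 else 0) + 2 * F.drift τ t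
        + F.shortfall η H (F.bestArm hK t) (t - τ) t ω
        + F.excess η H (ω t).1 (t - τ) t ω := by
    intro t ht
    rw [Finset.mem_range] at ht
    have hle : F.bestMean t - F.mean t (ω t).1 ≤ b := by
      rw [← mean_bestArm F hK]
      have h1 := (hF.1 t ht (F.bestArm hK t)).2
      have h2 := (hF.1 t ht (ω t).1).2
      rw [Set.mem_Icc] at h1 h2
      linarith
    have hd := drift_nonneg F τ t
    have hs := shortfall_nonneg F η H (F.bestArm hK t) (t - τ) t ω
    have hx := excess_nonneg F η H (ω t).1 (t - τ) t ω
    by_cases htK : t < K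
    · have : 0 ≤ b * (if pulls (ω t).1 (t - τ) t ω = 0 then (1 : ℝ) else 0) := by positivity
      rw [if_pos htK]
      linarith
    · have := bestMean_sub_mean_le hK hle (hω t ht (by omega))
      rw [if_neg htK]
      linarith
  have hsum := Finset.sum_le_sum hround
  simp only [Finset.sum_add_distrib, ← Finset.mul_sum] at hsum
  have t1 : ∑ t ∈ Finset.range T, (if t < K then (1 : ℝ) else 0) ≤ K := by
    rw [Finset.sum_boole]
    have : (Finset.range T).filter (· < K) ⊆ Finset.range K := fun t ht => by
      simp only [Finset.mem_filter] at ht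
      exact Finset.mem_range.2 ht.2
    have := Finset.card_le_card this
    rw [Finset.card_range] at this
    exact_mod_cast this
  have t2 : ∑ t ∈ Finset.range T, (if pulls (ω t).1 (t - τ) t ω = 0 then (1 : ℝ) else 0)
      ≤ (T / τ + 1 : ℕ) * K := by
    rw [sum_arm_eq_sum_epochs (fun k t => if pulls k (t - τ) t ω = 0 then (1 : ℝ) else 0) hτ]
    calc _ ≤ ∑ i ∈ Finset.range (T / τ + 1), ∑ k : Fin K, (1 : ℝ) :=
          Finset.sum_le_sum fun i _ => Finset.sum_le_sum fun k _ =>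
            sum_no_sample_le_one k (hmono i).1 (hmono i).2 ω
      _ = _ := by simp
  have t3 : ∑ t ∈ Finset.range T, F.drift τ t ≤ τ * V :=
    (sum_drift_le F τ T).trans (mul_le_mul_of_nonneg_left hF.2 hτ0.le)
  have t4 : ∑ t ∈ Finset.range T, F.excess η H (ω t).1 (t - τ) t ω ≤
      ∑ i ∈ Finset.range (T / τ + 1), 16 * (chainConst + √(2 * η)) * (√H *
        (2 * K + ∑ k, F.chainEnergy k (min (i * τ) T - τ) (min ((i + 1) * τ) T) H ω)) := by
    rw [sum_arm_eq_sum_epochs (fun k t => F.excess η H k (t - τ) t ω) hτ]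
    refine Finset.sum_le_sum fun i _ => ?_
    obtain ⟨m1, m2⟩ := hmono i
    refine (Finset.sum_le_sum fun k _ => sum_excess_le F hη hH k m1 m2 ω).trans ?_
    rw [← Finset.mul_sum, ← Finset.mul_sum]
    have hc := chainConst_nonneg
    gcongr
    rw [Finset.sum_add_distrib, Finset.sum_add_distrib, ← Finset.sum_div, ← Nat.cast_sum,
      sum_pulls]
    -- All arms together are selected at most `τ` times in an epoch, so the terms `selections / H`
    -- add up to at most `K`.
    have : ((min ((i + 1) * τ) T - min (i * τ) T : ℕ) : ℝ) / H ≤ K := by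
      have h1 : min ((i + 1) * τ) T - min (i * τ) T ≤ τ := by omega
      calc ((min ((i + 1) * τ) T - min (i * τ) T : ℕ) : ℝ) / H ≤ τ / H := by gcongr
        _ = K := by rw [hHdef]; field_simp
    simp only [Finset.sum_const, Finset.card_univ, Fintype.card_fin, nsmul_eq_mul, mul_one]
    linarith
  have u1 := mul_le_mul_of_nonneg_left t1 hb.le
  have u2 := mul_le_mul_of_nonneg_left t2 hb.le
  linarith

theorem lintegral_sum_chainEnergy_le (π : Policy K) {F : Env K} (hK : 0 < K) {T : ℕ}
    (hF : F.IsSubgaussian T) {τ u v : ℕ} (hτ : 0 < τ) (huv : u ≤ v) (hv : v ≤ T)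
    (hvu : v - u ≤ 2 * τ) :
    ∫⁻ ω, ENNReal.ofReal (∑ k, F.chainEnergy k u v (τ / K) ω) ∂(π.pathLaw F hK T)
      ≤ ENNReal.ofReal (3870720 * K) := by
  have hprob := isProbabilityMeasure_pathLaw π F hK T
  have hK0 : (0 : ℝ) < K := by exact_mod_cast hK
  have hτ0 : (0 : ℝ) < τ := by exact_mod_cast hτ
  have hH : (0 : ℝ) < τ / K := by positivity
  have h := lintegral_ofReal_sum_mono (μ := π.pathLaw F hK T) Finset.univ (fun _ => 1)
    (fun k ω => F.chainEnergy k u v (τ / K) ω)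
    (fun k ω => 1290240 * (1 + pulls k u v ω / (τ / K)))
    (fun _ _ => zero_le_one) (fun k => measurable_chainEnergy F k u v _)
    (fun k => by fun_prop)
    (fun k ω => chainEnergy_nonneg F k u v hH ω) (fun k ω => by positivity)
    (fun k _ => lintegral_chainEnergy_le π hK hF k huv hv hH)
  simp only [one_mul] at h
  refine h.trans ?_
  calc _ ≤ ∫⁻ _ω, ENNReal.ofReal (3870720 * K) ∂(π.pathLaw F hK T) := by
        refine lintegral_mono fun ω => ENNReal.ofReal_le_ofReal ?_
        rw [← Finset.mul_sum, Finset.sum_add_distrib, ← Finset.sum_div, ← Nat.cast_sum, sum_pulls]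
        -- An epoch together with the window preceding it lasts at most `2 * τ` rounds, so the
        -- constant is `1290240 * (1 + 2) = 3870720`.
        have : ((v - u : ℕ) : ℝ) / (τ / K) ≤ 2 * K := by
          calc ((v - u : ℕ) : ℝ) / (τ / K) ≤ ((2 * τ : ℕ) : ℝ) / (τ / K) := by gcongr
            _ = 2 * K := by push_cast; field_simp
        simp only [Finset.sum_const, Finset.card_univ, Fintype.card_fin, nsmul_eq_mul, mul_one]
        linarith
    _ = _ := by simp

theorem regret_le_of_lintegral_le (π : Policy K) (F : Env K) (hK : 0 < K) (T : ℕ) {B : ℝ}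
    (hB : 0 ≤ B)
    (h : ∫⁻ ω, ENNReal.ofReal (∑ t ∈ Finset.range T, (F.bestMean t - F.mean t (ω t).1))
      ∂(π.pathLaw F hK T) ≤ ENNReal.ofReal B) : π.regret F T ≤ B := by
  have hm : Measurable fun ω : Path K =>
      ∑ t ∈ Finset.range T, (F.bestMean t - F.mean t (ω t).1) :=
    Finset.measurable_sum _ fun t _ => measurable_const.sub
      ((measurable_from_top (f := F.mean t)).comp (measurable_fst.comp (measurable_pi_apply t)))
  have e : π.regret F T = ∫ ω, ∑ t ∈ Finset.range T, (F.bestMean t - F.mean t (ω t).1)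
      ∂(π.pathLaw F hK T) := by
    unfold Policy.pathLaw Policy.regret
    rw [integral_map (measurable_pad hK).aemeasurable hm.aestronglyMeasurable]
    congr 1
    funext h
    rw [← Fin.sum_univ_eq_sum_range fun t => F.bestMean t - F.mean t (Hist.pad hK h t).1]
    simp [Hist.pad]
  rw [e, integral_eq_lintegral_of_nonneg_ae
    (Filter.Eventually.of_forall fun ω => Finset.sum_nonneg fun t _ =>
      sub_nonneg.2 (mean_le_bestMean F t _)) hm.aestronglyMeasurable]
  exact ENNReal.toReal_le_of_le_ofReal hB h

/-- The regret of SW-MOSS for an arbitrary window length. -/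
theorem exists_regret_le {η b : ℝ} (hη : 1 / 2 < η) (hb : 0 < b) :
    ∃ C : ℝ, 0 ≤ C ∧ ∀ (a : ℝ) {K T τ : ℕ} {V : ℝ}, 0 < K → 0 ≤ V → K ≤ τ → τ ≤ T →
      ∀ π : Policy K, π.IsSWMOSS η τ T → ∀ F ∈ envClass K T V a b,
        π.regret F T ≤ C * (T / √(τ / K)) + 2 * (τ * V) := by
  obtain ⟨C₀, hC₀, hshort⟩ := exists_lintegral_shortfall_le hη
  set C₁ := 16 * (chainConst + √(2 * η)) with hC₁
  have hC₁0 : 0 ≤ C₁ := by have := chainConst_nonneg; positivity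
  -- With `G = T / √H` and `M` epochs, `K`, `M K` and `M K √H` are all at most `2 G`. The first
  -- rounds and the selections without a sample give `4 b`; the excess gives `2 * (2 + 3870720) =
  -- 7741444` times `C₁`.
  refine ⟨4 * b + C₀ + 7741444 * C₁, by positivity, ?_⟩
  intro a K T τ V hK hV hKτ hτT π hπ F hF
  have hprob := isProbabilityMeasure_pathLaw π F hK T
  have hτ : 0 < τ := by omega
  have hK0 : (0 : ℝ) < K := by exact_mod_cast hK
  have hτ0 : (0 : ℝ) < τ := by exact_mod_cast hτ
  have hKτ' : (K : ℝ) ≤ τ := by exact_mod_cast hKτ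
  have hτT' : (τ : ℝ) ≤ T := by exact_mod_cast hτT
  have hH : (0 : ℝ) < τ / K := by positivity
  have hsub : F.IsSubgaussian T := fun t ht k => (hF.1 t ht k).1
  set H : ℝ := τ / K with hHdef
  set M : ℕ := T / τ + 1 with hM
  set Z : Path K → ℝ := fun ω =>
    ∑ t ∈ Finset.range T, F.shortfall η H (F.bestArm hK t) (t - τ) t ω with hZ
  set E : ℕ → Path K → ℝ := fun i ω =>
    ∑ k, F.chainEnergy k (min (i * τ) T - τ) (min ((i + 1) * τ) T) H ω with hE
  have hE0 : ∀ i ω, 0 ≤ E i ω := fun i ω =>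
    Finset.sum_nonneg fun k _ => chainEnergy_nonneg F k _ _ hH ω
  have hZ0 : ∀ ω, 0 ≤ Z ω := fun ω => Finset.sum_nonneg fun t _ => shortfall_nonneg F _ _ _ _ _ _
  have hEm : ∀ i, Measurable (E i) := fun i =>
    Finset.measurable_sum _ fun k _ => measurable_chainEnergy F k _ _ _
  have hZm : Measurable Z := Finset.measurable_sum _ fun t _ => measurable_shortfall F _ _ _ _ _
  set c : ℝ := b * K + b * (M * K) + 2 * (τ * V) + M * (C₁ * (√H * (2 * K))) with hc
  have hc0 : 0 ≤ c := by positivity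
  have hZint : ∫⁻ ω, ENNReal.ofReal (Z ω) ∂(π.pathLaw F hK T)
      ≤ ENNReal.ofReal (T * (C₀ / √H)) := by
    calc ∫⁻ ω, ENNReal.ofReal (Z ω) ∂(π.pathLaw F hK T)
        = ∑ t ∈ Finset.range T, ∫⁻ ω, ENNReal.ofReal
            (F.shortfall η H (F.bestArm hK t) (t - τ) t ω) ∂(π.pathLaw F hK T) := by
          rw [← lintegral_finsetSum _ fun t _ => (measurable_shortfall F _ _ _ _ _).ennreal_ofReal]
          exact lintegral_congr fun ω =>
            ENNReal.ofReal_sum_of_nonneg fun t _ => shortfall_nonneg F _ _ _ _ _ _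
      _ ≤ ∑ t ∈ Finset.range T, ENNReal.ofReal (C₀ / √H) :=
          Finset.sum_le_sum fun t ht =>
            hshort π hK hsub _ (Finset.mem_range.1 ht).le hH
      _ = ENNReal.ofReal (T * (C₀ / √H)) := by
          rw [Finset.sum_const, Finset.card_range, nsmul_eq_mul, ENNReal.ofReal_mul (by positivity),
            ENNReal.ofReal_natCast]
  have hEint : ∫⁻ ω, ENNReal.ofReal (∑ i ∈ Finset.range M, C₁ * √H * E i ω) ∂(π.pathLaw F hK T)
      ≤ ENNReal.ofReal (M * (C₁ * √H * (3870720 * K))) := by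
    refine (lintegral_ofReal_sum_mono _ (fun _ => C₁ * √H) E (fun _ _ => 3870720 * (K : ℝ))
      (fun _ _ => by positivity) hEm (fun _ => measurable_const) hE0 (fun _ _ => by positivity)
      (fun i _ => ?_)).trans ?_
    · rw [lintegral_const, measure_univ, mul_one]
      refine lintegral_sum_chainEnergy_le π hK hsub hτ ?_ (min_le_right _ _) ?_
      all_goals
        rw [Nat.add_mul, one_mul]
        omega
    · simp
  have hreg : π.regret F T ≤ c + T * (C₀ / √H) + M * (C₁ * √H * (3870720 * K)) := by
    refine regret_le_of_lintegral_le π F hK T (by positivity) ?_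
    calc _ ≤ ∫⁻ ω, (ENNReal.ofReal c + ENNReal.ofReal (Z ω)
          + ENNReal.ofReal (∑ i ∈ Finset.range M, C₁ * √H * E i ω)) ∂(π.pathLaw F hK T) := by
          refine lintegral_mono_ae ?_
          filter_upwards [ae_act_ne_zero π F hK T] with ω hω
          rw [← ENNReal.ofReal_add hc0 (hZ0 ω), ← ENNReal.ofReal_add (add_nonneg hc0 (hZ0 ω))
            (Finset.sum_nonneg fun i _ => mul_nonneg (by positivity) (hE0 i ω))]
          refine ENNReal.ofReal_le_ofReal ?_
          refine (sum_regret_le (by linarith) hb hK hτ hF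
            fun t ht hKt => hπ.argmax t ht hKt _ _ (hω t ht)).trans (le_of_eq ?_)
          have e : ∑ i ∈ Finset.range M, C₁ * (√H * (2 * K + E i ω))
              = M * (C₁ * (√H * (2 * K))) + ∑ i ∈ Finset.range M, C₁ * √H * E i ω := by
            have : ∀ i, C₁ * (√H * (2 * K + E i ω)) = C₁ * (√H * (2 * K)) + C₁ * √H * E i ω :=
              fun i => by ring
            simp only [this]
            rw [Finset.sum_add_distrib, Finset.sum_const, Finset.card_range, nsmul_eq_mul]
          rw [e]
          ring
      _ ≤ _ := by
          rw [lintegral_add_left (f := fun ω => ENNReal.ofReal c + ENNReal.ofReal (Z ω))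
              (measurable_const.add hZm.ennreal_ofReal),
            lintegral_add_left measurable_const, lintegral_const, measure_univ, mul_one]
          refine (add_le_add (add_le_add le_rfl hZint) hEint).trans (le_of_eq ?_)
          rw [← ENNReal.ofReal_add hc0 (by positivity),
            ← ENNReal.ofReal_add (by positivity) (by positivity)]
  refine hreg.trans ?_
  have hs : 0 < √H := by positivity
  have hs2 : √H ^ 2 = H := Real.sq_sqrt hH.le
  have hs1 : 1 ≤ √H := by
    rw [Real.one_le_sqrt, hHdef, le_div_iff₀ hK0, one_mul]; exact hKτ'
  have hMle : (M : ℝ) * τ ≤ 2 * T := by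
    have h1 : (T / τ) * τ ≤ T := Nat.div_mul_le_self T τ
    have h2 : M * τ ≤ 2 * T := by rw [hM, Nat.add_mul, one_mul]; omega
    exact_mod_cast h2
  have hM1 : (1 : ℝ) ≤ M := by rw [hM]; push_cast; linarith [Nat.cast_nonneg (α := ℝ) (T / τ)]
  set G : ℝ := T / √H with hG
  have hG0 : 0 ≤ G := by positivity
  have hτH : (τ : ℝ) = K * √H ^ 2 := by rw [hs2, hHdef]; field_simp
  have g1 : M * (√H * K) ≤ 2 * G := by
    rw [hG, mul_div_assoc', le_div_iff₀ hs]
    rw [hτH] at hMle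
    linarith
  have g2 : M * (K : ℝ) ≤ 2 * G := by
    refine le_trans ?_ g1
    have : (M : ℝ) * (1 * K) ≤ M * (√H * K) := by gcongr
    linarith
  have g3 : (K : ℝ) ≤ 2 * G := by
    refine le_trans ?_ g2
    have : 1 * (K : ℝ) ≤ M * K := by gcongr
    linarith
  have e1 : T * (C₀ / √H) = C₀ * G := by rw [hG]; ring
  rw [e1, hc]
  have k1 := mul_le_mul_of_nonneg_left g1 hC₁0
  have k2 := mul_le_mul_of_nonneg_left g2 hb.le
  have k3 := mul_le_mul_of_nonneg_left g3 hb.le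
  linarith

/-! ### The choice of the window length -/

/-- Writing `K`, `T` and `V` as cubes turns every fractional power into a rational expression. The
unrounded window makes `τ V` and `T / √(τ / K)` equal. -/
theorem window_bounds {K T V : ℝ} (hK : 1 ≤ K) (hV : 0 < V) (hT : 0 < T) (hKV : K * V ≤ T) :
    K ≤ K ^ (1 / 3 : ℝ) * (T / V) ^ (2 / 3 : ℝ) ∧
    K ^ (1 / 3 : ℝ) * (T / V) ^ (2 / 3 : ℝ) * V = (K * V) ^ (1 / 3 : ℝ) * T ^ (2 / 3 : ℝ) ∧
    T / √(K ^ (1 / 3 : ℝ) * (T / V) ^ (2 / 3 : ℝ) / K) = (K * V) ^ (1 / 3 : ℝ) * T ^ (2 / 3 : ℝ) := by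
  have hK0 : 0 < K := by linarith
  obtain ⟨k, hk, rfl⟩ : ∃ k : ℝ, 0 < k ∧ K = k ^ 3 :=
    ⟨K ^ (1 / 3 : ℝ), by positivity, by
      rw [← Real.rpow_natCast, ← Real.rpow_mul hK0.le]; norm_num⟩
  obtain ⟨x, hx, rfl⟩ : ∃ x : ℝ, 0 < x ∧ T = x ^ 3 :=
    ⟨T ^ (1 / 3 : ℝ), by positivity, by
      rw [← Real.rpow_natCast, ← Real.rpow_mul hT.le]; norm_num⟩
  obtain ⟨v, hv, rfl⟩ : ∃ v : ℝ, 0 < v ∧ V = v ^ 3 :=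
    ⟨V ^ (1 / 3 : ℝ), by positivity, by
      rw [← Real.rpow_natCast, ← Real.rpow_mul hV.le]; norm_num⟩
  have c1 : ∀ y : ℝ, 0 < y → (y ^ 3) ^ (1 / 3 : ℝ) = y := fun y hy => by
    rw [← Real.rpow_natCast, ← Real.rpow_mul hy.le]; norm_num
  have c2 : ∀ y : ℝ, 0 < y → (y ^ 3) ^ (2 / 3 : ℝ) = y ^ 2 := fun y hy => by
    rw [← Real.rpow_natCast, ← Real.rpow_mul hy.le, ← Real.rpow_natCast]; norm_num
  rw [← mul_pow, ← div_pow, c1 k hk, c2 _ (div_pos hx hv), c1 _ (mul_pos hk hv), c2 x hx]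
  have hkv : k * v ≤ x := by
    rw [← mul_pow] at hKV
    exact le_of_pow_le_pow_left₀ (by norm_num) hx.le hKV
  refine ⟨?_, by field_simp, ?_⟩
  · have : k ≤ x / v := by rwa [le_div_iff₀ hv]
    calc k ^ 3 = k * k ^ 2 := by ring
      _ ≤ k * (x / v) ^ 2 := by gcongr
  · have e : k * (x / v) ^ 2 / k ^ 3 = (x / (v * k)) ^ 2 := by field_simp
    rw [e, Real.sqrt_sq (by positivity)]
    field_simp

theorem regret_le_mul_horizon {F : Env K} {V a b : ℝ} (hK : 0 < K) {T : ℕ} (hb : 0 ≤ b)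
    (hF : F ∈ envClass K T V a b) (π : Policy K) : π.regret F T ≤ b * T := by
  have hprob := isProbabilityMeasure_pathLaw π F hK T
  refine regret_le_of_lintegral_le π F hK T (by positivity) ?_
  calc _ ≤ ∫⁻ _ω, ENNReal.ofReal (b * T) ∂(π.pathLaw F hK T) := by
        refine lintegral_mono fun ω => ENNReal.ofReal_le_ofReal ?_
        calc _ ≤ ∑ t ∈ Finset.range T, b := by
              refine Finset.sum_le_sum fun t ht => ?_
              rw [Finset.mem_range] at ht
              rw [← mean_bestArm F hK]
              have h1 := (hF.1 t ht (F.bestArm hK t)).2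
              have h2 := (hF.1 t ht (ω t).1).2
              rw [Set.mem_Icc] at h1 h2
              linarith
          _ = b * T := by simp [mul_comm]
    _ = _ := by simp

end Bandit

end

theorem theorem2 (η b : ℝ) (hη : 1 / 2 < η) (hb : 0 < b) :
    ∃ C : ℝ, ∀ (a : ℝ) (K T : ℕ) (V : ℝ), 0 < K → 0 < V → Bandit.swWindow K T V ≤ T →
      ∀ π : Bandit.Policy K, π.IsSWMOSS η (Bandit.swWindow K T V) T →
        π.worstCaseRegret T V a b
          ≤ ((C * (((K : ℝ) * V) ^ (1 / 3 : ℝ) * (T : ℝ) ^ (2 / 3 : ℝ)) : ℝ) : EReal) := by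
  obtain ⟨C, hC, hreg⟩ := Bandit.exists_regret_le hη hb
  -- The summand `b` covers `T < K V`, where the trivial bound `b T` suffices. Otherwise the window
  -- is at least `K`, and `4` absorbs the drift: rounding up at most doubles the window, since its
  -- unrounded length is at least `1`.
  refine ⟨b + C + 4, ?_⟩
  intro a K T V hK hV hτT π hπ
  refine iSup₂_le fun F hF => EReal.coe_le_coe_iff.2 ?_
  have hK1 : (1 : ℝ) ≤ K := by exact_mod_cast hK
  have hT0 : (0 : ℝ) ≤ T := Nat.cast_nonneg T
  set Φ : ℝ := ((K : ℝ) * V) ^ (1 / 3 : ℝ) * (T : ℝ) ^ (2 / 3 : ℝ) with hΦ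
  have hΦ0 : 0 ≤ Φ := by positivity
  rcases lt_or_ge (T : ℝ) (K * V) with h | h
  · have h1 : (T : ℝ) ≤ Φ := by
      calc (T : ℝ) = (T : ℝ) ^ (1 / 3 : ℝ) * (T : ℝ) ^ (2 / 3 : ℝ) := by
            rw [← Real.rpow_add_of_nonneg hT0 (by norm_num) (by norm_num)]; norm_num
        _ ≤ Φ := by rw [hΦ]; gcongr
    have h2 := Bandit.regret_le_mul_horizon hK hb.le hF π
    nlinarith [mul_le_mul_of_nonneg_left h1 hb.le, mul_nonneg hC hΦ0]
  · have hT : (0 : ℝ) < T := lt_of_lt_of_le (by positivity) h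
    obtain ⟨w1, w2, w3⟩ := Bandit.window_bounds hK1 hV hT h
    rw [← hΦ] at w2 w3
    set x : ℝ := (K : ℝ) ^ (1 / 3 : ℝ) * ((T : ℝ) / V) ^ (2 / 3 : ℝ) with hx
    have hxτ : x ≤ Bandit.swWindow K T V := Nat.le_ceil x
    have hτx : (Bandit.swWindow K T V : ℝ) < x + 1 := Nat.ceil_lt_add_one (by positivity)
    have hKτ : K ≤ Bandit.swWindow K T V := by exact_mod_cast w1.trans hxτ
    refine (hreg a hK hV.le hKτ hτT π hπ F hF).trans ?_
    have hx0 : 0 < x := by linarith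
    have h1 : (T : ℝ) / √(Bandit.swWindow K T V / K) ≤ Φ := by
      rw [← w3]
      gcongr
    have h2 : (Bandit.swWindow K T V : ℝ) * V ≤ 2 * Φ := by
      rw [← w2]
      nlinarith
    nlinarith [mul_le_mul_of_nonneg_left h1 hC, mul_nonneg hb.le hΦ0]
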